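/- **Conventions.** A quadratic set is a set $Z$ with a bijection $r:Z\times Z\to Z\times Z$, written $r(x,y)=({}^xy,x^y)$. It is *braided* if $r$ satisfies the braid relation $r^{12}r^{23}r^{12}=r^{23}r^{12}r^{23}$ on $Z^3$; *non-degenerate* if all maps $y\mapsto{}^xy$ and $y\mapsto y^x$ are bijections of $Z$; *2-cancellative* if for every positive integer $k$ less than the (possibly infinite) order of $r$, $r^k(x,y)=(x,z)$ implies $z=y$ and $r^k(x,y)=(t,y)$ implies $t=x$. $S(Z,r)$ and $G(Z,r)=G_Z$ are the monoid and the group generated by $Z$ with relations $xy={}^xy\,x^y$ $(x,y\in Z)$. $(Z,r)$ is *injective* if $Z\to G_Z$ is injective. A subset $X$ is *$r$-invariant* if $r(X\times X)=X\times X$; it then carries the restriction of $r$. $Z$ is a *generalized strong twisted union* $X\bowtie^*Y$ of $r$-invariant subsets $X,Y$ (with the restrictions $r_1,r_2$ of $r$) if $Z=X\sqcup Y$, the ground actions of $X$ and $Y$ on each other are defined (${}^\alpha x,\,x^\alpha\in X$ and ${}^x\alpha,\,\alpha^x\in Y$ for $x\in X,\alpha\in Y$), and for all $x,y\in X$, $\alpha,\beta\in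 Y$ $$(*)\qquad {}^{\alpha^y}x={}^\alpha x,\quad x^{{}^y\alpha}=x^\alpha,\quad {}^{x^\beta}\alpha={}^x\alpha,\quad \alpha^{{}^\beta x}=\alpha^x .$$ A *matched pair* of monoids $(S,T)$ consists of a left action ${}^ua$ of $T$ on $S$ and a right action $u^a$ of $S$ on $T$ $(a,b\in S;\ u,v\in T)$ with ${}^u1=1$, $1^a=1$, ${}^u(ab)={}^ua\cdot{}^{u^a}b$, $(uv)^a=u^{{}^va}\cdot v^a$. A *braided monoid* is a monoid $M$ with a matched pair structure $(M,M)$ such that ${}^uv\cdot u^v=uv$ and $r_M(u,v)=({}^uv,u^v)$ is bijective and satisfies the braid relation; a braided monoid that is a group is a *braided group*. Let $S,T,U$ be braided monoids with homomorphisms $i:S\to U$, $j:T\to U$. We say that $U$ is a *generalized strong twisted union* $S\bowtie^*T$ along $i,j$, with ground actions given by matched pairs $(S,T)$ and $(T,S)$ (actions ${}^ua,\,u^a$ and ${}^au,\,a^u$, for $a\in S,u\in T$), if * $r_U\circ(i\times i)=(i\times i)\circ r_S$ and $r_U\circ(j\times j)=(j\times j)\circ r_T$; * $r_U(j(u),i(a))=(i({}^ua),j(u^a))$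 and $r_U(i(a),j(u))=(j({}^au),i(a^u))$, and the maps $T\times S\to S\times T$, $(u,a)\mapsto({}^ua,u^a)$ and $S\times T\to T\times S$, $(a,u)\mapsto({}^au,a^u)$ are bijective; * $U=i(S)j(T)=j(T)i(S)$; * the identities $(*)$ hold for all $a,b\in S$, $u,v\in T$: ${}^{u^b}a={}^ua$, $a^{{}^bu}=a^u$, ${}^{a^v}u={}^au$, $u^{{}^va}=u^a$. **Theorem.** Let $(Z,r)$ be a non-degenerate 2-cancellative braided set which is a generalized strong twisted union $Z=X\bowtie^*Y$ of its $r$-invariant subsets $X$ and $Y$. 1. Each of the monoids $U=S(Z,r)$, $S=S(X,r_1)$, $T=S(Y,r_2)$ has a unique structure of braided monoid extending $r$, $r_1$, $r_2$ respectively. The canonical homomorphisms $S\to U$ and $T\to U$ are injective, and their images meet only in $1$. There is a unique pair of matched pairs $(S,T)$, $(T,S)$ extending the ground actions of $X$ and $Y$ on each other, and with these $U=S\bowtie^*T$ along the canonical homomorphisms. 2. If $(Z,r)$ is injective, then $(X,r_1)$ and $(Y,r_2)$ are injective. Moreover $G_Z$, $G_X=G(X,r_1)$, $G_Y=G(Y,r_2)$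 have unique structures of braided group extending $r$, $r_1$, $r_2$ along the canonical maps from $Z$, $X$, $Y$; there is a unique pair of matched pairs $(G_X,G_Y)$, $(G_Y,G_X)$ extending the ground actions of $X$ and $Y$ on each other, and with these $G_Z=G_X\bowtie^*G_Y$ along the canonical homomorphisms $G_X\to G_Z$, $G_Y\to G_Z$ (which need not be injective). -/

import Mathlib

/-! ### Quadratic sets: a set `Z` with a bijection `r` of `Z × Z`, `r (x, y) = (ˣy, xʸ)` -/

namespace QuadraticSet

/-- The left action `ˣy` of a map `r (x, y) = (ˣy, xʸ)`. -/
def lact {Z : Type*} (r : Z × Z → Z × Z) (x y : Z) : Z := (r (x, y)).1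

/-- The right action `xʸ` of a map `r (x, y) = (ˣy, xʸ)`; the first argument is acted upon. -/
def ract {Z : Type*} (r : Z × Z → Z × Z) (x y : Z) : Z := (r (x, y)).2

/-- `r × id` on `Z × Z × Z`. -/
def r12 {Z : Type*} (r : Z × Z → Z × Z) (p : Z × Z × Z) : Z × Z × Z :=
  ((r (p.1, p.2.1)).1, (r (p.1, p.2.1)).2, p.2.2)

/-- `id × r` on `Z × Z × Z`. -/
def r23 {Z : Type*} (r : Z × Z → Z × Z) (p : Z × Z × Z) : Z × Z × Z :=
  (p.1, r p.2)

/-- The Yang-Baxter equation (braid relation). -/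
def IsBraided {Z : Type*} (r : Z × Z → Z × Z) : Prop :=
  ∀ p : Z × Z × Z, r12 r (r23 r (r12 r p)) = r23 r (r12 r (r23 r p))

/-- All maps `y ↦ ˣy` and `y ↦ yˣ` are bijective. -/
def Nondegenerate {Z : Type*} (r : Z × Z → Z × Z) : Prop :=
  ∀ x : Z, Function.Bijective (fun y => lact r x y) ∧ Function.Bijective (fun y => ract r y x)

/-- 2-cancellativity; `orderOf r = 0` means that `r` has infinite order. -/
def TwoCancellative {Z : Type*} (r : Equiv.Perm (Z × Z)) : Prop :=
  ∀ k : ℕ, 0 < k → (orderOf r = 0 ∨ k < orderOf r) → ∀ x y z : Z,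
    ((r ^ k) (x, y) = (x, z) → z = y) ∧ ((r ^ k) (x, y) = (z, y) → x = z)

/-- `X` is `r`-invariant: `r (X × X) = X × X` (here `r` is a bijection). -/
def IsInvariant {Z : Type*} (r : Equiv.Perm (Z × Z)) (X : Set Z) : Prop :=
  ∀ p : Z × Z, r p ∈ X ×ˢ X ↔ p ∈ X ×ˢ X

/-- The quadratic set induced on an `r`-invariant subset. -/
def induced {Z : Type*} (r : Equiv.Perm (Z × Z)) {X : Set Z} (hX : IsInvariant r X) :
    Equiv.Perm (X × X) :=
  (Equiv.Set.prod X X).permCongr (r.subtypePerm hX)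

theorem induced_apply {Z : Type*} (r : Equiv.Perm (Z × Z)) {X : Set Z} (hX : IsInvariant r X)
    (x y : X) : Prod.map Subtype.val Subtype.val (induced r hX (x, y)) = r (x.1, y.1) := rfl

/-- `Z` is the generalized strong twisted union of its `r`-invariant subsets `X` and `Y`
with the induced maps. The fields `map_XY` and `map_YX` say that the ground actions (of `X` and `Y`
on each other) are defined; they hold iff the induced quadratic sets are non-degenerate, when `r`
is non-degenerate. -/
structure IsGenSTU {Z : Type*} (r : Equiv.Perm (Z × Z)) (X Y : Set Z) : Prop where
  disjoint : Disjoint X Y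
  union : X ∪ Y = Set.univ
  invariant_X : IsInvariant r X
  invariant_Y : IsInvariant r Y
  map_XY : ∀ x ∈ X, ∀ α ∈ Y, lact r x α ∈ Y ∧ ract r x α ∈ X
  map_YX : ∀ α ∈ Y, ∀ x ∈ X, lact r α x ∈ X ∧ ract r α x ∈ Y
  stu1 : ∀ x ∈ X, ∀ y ∈ X, ∀ α ∈ Y, lact r (ract r α y) x = lact r α x
  stu2 : ∀ x ∈ X, ∀ y ∈ X, ∀ α ∈ Y, ract r x (lact r y α) = ract r x α
  stu3 : ∀ x ∈ X, ∀ α ∈ Y, ∀ β ∈ Y, lact r (ract r x β) α = lact r x α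
  stu4 : ∀ x ∈ X, ∀ α ∈ Y, ∀ β ∈ Y, ract r α (lact r β x) = ract r α x

/-! ### The monoid and the group of a quadratic set -/

/-- The defining relations `x y = ˣy xʸ` of the monoid (those at fixed points of `r` are trivial). -/
inductive MonoidRel {Z : Type*} (r : Z × Z → Z × Z) : FreeMonoid Z → FreeMonoid Z → Prop
  | intro (x y : Z) : MonoidRel r (FreeMonoid.of x * FreeMonoid.of y)
      (FreeMonoid.of (lact r x y) * FreeMonoid.of (ract r x y))

/-- The monoid `S(Z, r)`. -/
abbrev StrMonoid {Z : Type*} (r : Z × Z → Z × Z) : Type _ := PresentedMonoid (MonoidRel r)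

/-- The canonical map `Z → S(Z, r)`. -/
def StrMonoid.of {Z : Type*} (r : Z × Z → Z × Z) (x : Z) : StrMonoid r :=
  PresentedMonoid.of (MonoidRel r) x

/-- The defining relations `x y = ˣy xʸ` of the group. -/
def groupRels {Z : Type*} (r : Z × Z → Z × Z) : Set (FreeGroup Z) :=
  {w | ∃ x y : Z, w = (FreeGroup.of x * FreeGroup.of y) *
    (FreeGroup.of (lact r x y) * FreeGroup.of (ract r x y))⁻¹}

/-- The group `G(Z, r)`. -/
abbrev StrGroup {Z : Type*} (r : Z × Z → Z × Z) : Type _ := PresentedGroup (groupRels r)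

/-- The canonical map `Z → G(Z, r)`. -/
def StrGroup.of {Z : Type*} (r : Z × Z → Z × Z) (x : Z) : StrGroup r :=
  PresentedGroup.of x

/-- `(Z, r)` is injective: `Z` embeds in `G(Z, r)`. -/
def IsInjective {Z : Type*} (r : Z × Z → Z × Z) : Prop :=
  Function.Injective (StrGroup.of r)

theorem StrMonoid.of_rel {Z : Type*} (r : Z × Z → Z × Z) (x y : Z) :
    StrMonoid.of r x * StrMonoid.of r y =
      StrMonoid.of r (lact r x y) * StrMonoid.of r (ract r x y) :=
  PresentedMonoid.mk_eq_mk_of_rel (MonoidRel.intro x y)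

theorem StrGroup.of_rel {Z : Type*} (r : Z × Z → Z × Z) (x y : Z) :
    StrGroup.of r x * StrGroup.of r y =
      StrGroup.of r (lact r x y) * StrGroup.of r (ract r x y) :=
  mul_inv_eq_one.mp (PresentedGroup.one_of_mem (rels := groupRels r) ⟨x, y, rfl⟩)

/-- The canonical homomorphism `S(X, r|X) → S(Z, r)`, `x ↦ x`. -/
def monoidIncl {Z : Type*} (r : Equiv.Perm (Z × Z)) {X : Set Z} (hX : IsInvariant r X) :
    StrMonoid (induced r hX) →* StrMonoid r :=
  PresentedMonoid.lift (fun x : X => StrMonoid.of r x.1) (by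
    rintro _ _ ⟨x, y⟩
    simp only [map_mul, FreeMonoid.lift_eval_of]
    exact StrMonoid.of_rel r x.1 y.1)

/-- The canonical homomorphism `G(X, r|X) → G(Z, r)`, `x ↦ x`. -/
def groupIncl {Z : Type*} (r : Equiv.Perm (Z × Z)) {X : Set Z} (hX : IsInvariant r X) :
    StrGroup (induced r hX) →* StrGroup r :=
  PresentedGroup.toGroup (f := fun x : X => StrGroup.of r x.1) (by
    rintro _ ⟨x, y, rfl⟩
    simp only [map_mul, map_inv, FreeGroup.lift_apply_of]
    exact mul_inv_eq_one.mpr (StrGroup.of_rel r x.1 y.1))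

/-! ### Matched pairs and braided monoids -/

/-- A matched pair of monoids `(S, T)`: a left action `lact a u = ᵃu` of `T` on `S` and a right
action `ract a u = aᵘ` of `S` on `T` (`a ∈ T`, `u ∈ S`). -/
structure MatchedPair (S T : Type*) [Monoid S] [Monoid T] where
  lact : T → S → S
  ract : T → S → T
  lact_one : ∀ a, lact a 1 = 1
  one_lact : ∀ u, lact 1 u = u
  one_ract : ∀ u, ract 1 u = 1
  ract_one : ∀ a, ract a 1 = a
  mul_lact : ∀ a b u, lact (a * b) u = lact a (lact b u)
  ract_mul : ∀ a u v, ract a (u * v) = ract (ract a u) v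
  lact_mul : ∀ a u v, lact a (u * v) = lact a u * lact (ract a u) v
  mul_ract : ∀ a b u, ract (a * b) u = ract a (lact b u) * ract b u

/-- The map `(a, u) ↦ (ᵃu, aᵘ)` of a matched pair. -/
def MatchedPair.map {S T : Type*} [Monoid S] [Monoid T] (P : MatchedPair S T) (p : T × S) : S × T :=
  (P.lact p.1 p.2, P.ract p.1 p.2)

/-- A braided monoid structure on `M`: a matched pair `(M, M)` with `ᵘv uᵛ = u v` whose map
`r_M (u, v) = (ᵘv, uᵛ)` is bijective and satisfies the Yang-Baxter equation. On a group this is a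
braided group structure. -/
structure BraidedMonoid (M : Type*) [Monoid M] extends MatchedPair M M where
  lact_mul_ract : ∀ u v, lact u v * ract u v = u * v
  bijective : Function.Bijective toMatchedPair.map
  isBraided : IsBraided toMatchedPair.map

/-- The map `r_M` of a braided monoid. -/
def BraidedMonoid.braiding {M : Type*} [Monoid M] (B : BraidedMonoid M) : M × M → M × M :=
  B.toMatchedPair.map

/-- `r_M` extends `r` along `ι : Z → M`. -/
def BraidedMonoid.Extends {Z M : Type*} [Monoid M] (B : BraidedMonoid M) (r : Z × Z → Z × Z)
    (ι : Z → M) : Prop :=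
  ∀ x y : Z, B.braiding (ι x, ι y) = Prod.map ι ι (r (x, y))

/-- `B` is the braided monoid structure associated with `r`: the unique one extending `r`. -/
def BraidedMonoid.IsAssociated {Z M : Type*} [Monoid M] (B : BraidedMonoid M) (r : Z × Z → Z × Z)
    (ι : Z → M) : Prop :=
  B.Extends r ι ∧ ∀ B' : BraidedMonoid M, B'.Extends r ι → B' = B

/-! ### Generalized strong twisted unions of braided monoids -/

/-- The braided monoid `U` is a generalized strong twisted union of the braided monoids `S` and `T`,
along the homomorphisms `i : S → U`, `j : T → U`. The ground actions of `S` and `T` on each other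
form two matched pairs: `P`, with `ᵘa` and `uᵃ`, and `Q`, with `ᵃu` and `aᵘ` (`a ∈ S`, `u ∈ T`);
`r_U` restricts to `r_S`, `r_T` and to the bijections `T × S → S × T` and `S × T → T × S` given by
the ground actions; every element of `U` is a product of one from `S` and one from `T`, in either
order; and the four identities hold. -/
structure IsGenSTUMonoid {S T U : Type*} [Monoid S] [Monoid T] [Monoid U]
    (BS : BraidedMonoid S) (BT : BraidedMonoid T) (BU : BraidedMonoid U)
    (i : S →* U) (j : T →* U) (P : MatchedPair S T) (Q : MatchedPair T S) : Prop where
  map_SS : ∀ a b, BU.braiding (i a, i b) = Prod.map i i (BS.braiding (a, b))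
  map_TT : ∀ u v, BU.braiding (j u, j v) = Prod.map j j (BT.braiding (u, v))
  map_TS : ∀ u a, BU.braiding (j u, i a) = Prod.map i j (P.map (u, a))
  map_ST : ∀ a u, BU.braiding (i a, j u) = Prod.map j i (Q.map (a, u))
  bijective_TS : Function.Bijective P.map
  bijective_ST : Function.Bijective Q.map
  factor_ST : ∀ w, ∃ a u, w = i a * j u
  factor_TS : ∀ w, ∃ u a, w = j u * i a
  stu1 : ∀ a b u, P.lact (P.ract u b) a = P.lact u a
  stu2 : ∀ a b u, Q.ract a (Q.lact b u) = Q.ract a u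
  stu3 : ∀ a u v, Q.lact (Q.ract a v) u = Q.lact a u
  stu4 : ∀ a u v, P.ract u (P.lact v a) = P.ract u a

/-- The matched pairs `P`, `Q` extend the ground actions of `Z = X ∪ Y` along `ι : X → S` and
`κ : Y → T`. -/
def ExtendsGround {Z S T : Type*} [Monoid S] [Monoid T] {r : Equiv.Perm (Z × Z)} {X Y : Set Z}
    (h : IsGenSTU r X Y) (ι : X → S) (κ : Y → T) (P : MatchedPair S T) (Q : MatchedPair T S) :
    Prop :=
  ∀ (x : X) (α : Y),
    P.lact (κ α) (ι x) = ι ⟨lact r α x, (h.map_YX α α.2 x x.2).1⟩ ∧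
    P.ract (κ α) (ι x) = κ ⟨ract r α x, (h.map_YX α α.2 x x.2).2⟩ ∧
    Q.lact (ι x) (κ α) = κ ⟨lact r x α, (h.map_XY x x.2 α α.2).1⟩ ∧
    Q.ract (ι x) (κ α) = ι ⟨ract r x α, (h.map_XY x x.2 α α.2).2⟩

/-- `U` is canonically the generalized strong twisted union of `S` and `T`, extending the ground
actions of `Z = X ∪ Y`: the matched pairs extending these actions exist, are unique, and exhibit
`U` as such a union. -/
def IsCanonicalGenSTU {Z S T U : Type*} [Monoid S] [Monoid T] [Monoid U]
    {r : Equiv.Perm (Z × Z)} {X Y : Set Z} (h : IsGenSTU r X Y) (ι : X → S) (κ : Y → T)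
    (BS : BraidedMonoid S) (BT : BraidedMonoid T) (BU : BraidedMonoid U)
    (i : S →* U) (j : T →* U) : Prop :=
  ∃ (P : MatchedPair S T) (Q : MatchedPair T S),
    ExtendsGround h ι κ P Q ∧
    (∀ P' Q', ExtendsGround h ι κ P' Q' → P' = P ∧ Q' = Q) ∧
    IsGenSTUMonoid BS BT BU i j P Q

end QuadraticSet

/-! ### Presentations by quadratic relations -/

namespace QuadraticSet

universe u

/-! Only two properties of a structure monoid or group matter: the universal property (`lift`) and
induction over generators (`gen`, which plays the role of uniqueness). `Presents G` records both, so
that monoids (`G` false) and groups (`G` true) share one proof; the group case only adds an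
induction step for inverses of generators.

To extend ground actions of `A` and `B` to `S` and `T`, move a single `β : B` past a word `a`. It
comes out as `βᵃ` and turns `a` into `ᵝa`. This is an action of `S` on the set `B` with a cocycle in
`S`, and the braid relation on `B × A × A` says exactly that the relations of `S` are respected. The
braid relation on `B × B × A` then lets `T` act on `S` with a cocycle in `T`, and this is the
matched pair (`GroundActions.exists_matchedPair`). Its laws, its uniqueness and its naturality all
follow from one principle: a map commuting with actions and cocycles on generators does so
everywhere (`RightCocycle.hom_of_gen`, `LeftCocycle.hom_of_gen`).

Applied to `r` itself this yields the braided structures, applied to `X` against `Y` the two mixed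
matched pairs; naturality along `i` and `j` shows that `r_U` restricts to all of them. The
identities `(*)` and the factorizations of `U` also spread from generators. Monoids and groups need
separate arguments only for bijectivity and for the middle component of the braid relation, where
groups can divide and monoids need an induction.

Injectivity of `S → U` comes from a retraction of `U` onto `S` with a zero adjoined, killing `Y`. -/

/-- `S` is presented by the map `ι : X → S` and the quadratic relations of `r`: as a monoid, or as
a group if `G` holds. -/
structure Presents (G : Prop) {X S : Type u} [Monoid S] (r : X × X → X × X) (ι : X → S) :
    Prop where
  rel : ∀ x y, ι x * ι y = ι (lact r x y) * ι (ract r x y)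
  unit : G → ∀ x, IsUnit (ι x)
  lift : ∀ {M : Type u} [Monoid M] (f : X → M),
    (∀ x y, f x * f y = f (lact r x y) * f (ract r x y)) → (G → ∀ x, IsUnit (f x)) →
    ∃ φ : S →* M, ∀ x, φ (ι x) = f x
  gen : ∀ p : S → Prop, p 1 → (∀ a b, p a → p b → p (a * b)) → (∀ x, p (ι x)) →
    (G → ∀ x b, ι x * b = 1 → b * ι x = 1 → p b) → ∀ a, p a

theorem StrMonoid.presents {X : Type u} (r : X × X → X × X) :
    Presents False r (StrMonoid.of r) where
  rel := StrMonoid.of_rel r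
  unit := False.elim
  lift f hf _ := ⟨PresentedMonoid.lift f (by
    rintro _ _ ⟨x, y⟩
    simpa only [map_mul, FreeMonoid.lift_eval_of] using hf x y), fun x => rfl⟩
  gen p h1 hmul hι _ a := by
    induction a using PresentedMonoid.inductionOn with | _ w
    induction w using FreeMonoid.inductionOn with
    | one => exact h1
    | of x => exact hι x
    | mul v w hv hw => rw [map_mul]; exact hmul _ _ hv hw

theorem StrGroup.presents {X : Type u} (r : X × X → X × X) :
    Presents True r (StrGroup.of r) where
  rel := StrGroup.of_rel r
  unit _ x := Group.isUnit _
  lift {M} _ f hf hu := by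
    choose g hg using hu trivial
    have hrel : ∀ w ∈ groupRels r, FreeGroup.lift g w = 1 := by
      rintro _ ⟨x, y, rfl⟩
      simp only [map_mul, map_inv, FreeGroup.lift_apply_of]
      refine mul_inv_eq_one.mpr (Units.ext ?_)
      simpa only [Units.val_mul, hg] using hf x y
    refine ⟨(Units.coeHom M).comp (PresentedGroup.toGroup hrel), fun x => ?_⟩
    rw [← hg x]
    exact congrArg Units.val (PresentedGroup.toGroup.of hrel)
  gen p h1 hmul hι hinv a := by
    have ha : a ∈ Subgroup.closure (Set.range (PresentedGroup.of (rels := groupRels r))) := by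
      rw [PresentedGroup.closure_range_of]; trivial
    induction ha using Subgroup.closure_induction'' with
    | one => exact h1
    | mem x hx => obtain ⟨x, rfl⟩ := hx; exact hι x
    | inv_mem x hx =>
      obtain ⟨x, rfl⟩ := hx
      exact hinv trivial x _ (mul_inv_cancel _) (inv_mul_cancel _)
    | mul x y _ _ hx hy => exact hmul _ _ hx hy

theorem Presents.isUnit {G : Prop} {X S : Type u} [Monoid S] {r : X × X → X × X} {ι : X → S}
    (h : Presents G r ι) (hG : G) (a : S) : IsUnit a :=
  h.gen IsUnit isUnit_one (fun _ _ ha hb => ha.mul hb) (h.unit hG)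
    (fun _ x b h1 h2 => ⟨⟨b, ι x, h2, h1⟩, rfl⟩) a

/-! ### Actions with a cocycle -/

/-- A right action of `S` on `Q` with a cocycle valued in `M`. -/
structure RightCocycle (S Q M : Type*) [Monoid S] [Monoid M] where
  act : Q → S → Q
  coc : Q → S → M
  act_one : ∀ q, act q 1 = q
  act_mul : ∀ q a b, act q (a * b) = act (act q a) b
  coc_one : ∀ q, coc q 1 = 1
  coc_mul : ∀ q a b, coc q (a * b) = coc q a * coc (act q a) b

/-- A left action of `T` on `Q` with a cocycle valued in `M`. -/
structure LeftCocycle (T Q M : Type*) [Monoid T] [Monoid M] where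
  act : T → Q → Q
  coc : T → Q → M
  one_act : ∀ q, act 1 q = q
  mul_act : ∀ a b q, act (a * b) q = act a (act b q)
  one_coc : ∀ q, coc 1 q = 1
  mul_coc : ∀ a b q, coc (a * b) q = coc a (act b q) * coc b q

section Cocycle

variable {G : Prop} {X S : Type u} [Monoid S] {r : X × X → X × X} {ι : X → S}

/-- For the inverse `b` of a generator `x`, the action of `b` is forced since `x` undoes it, and the
values of both cocycles at `b` are inverse to the same value at `x`. Hence `M` itself need not be a
group. -/
theorem RightCocycle.hom_of_gen (h : Presents G r ι) {Q Q' M : Type*} [Monoid M]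
    (C : RightCocycle S Q M) (D : RightCocycle S Q' M) (f : Q → Q')
    (hf : ∀ q x, f (C.act q (ι x)) = D.act (f q) (ι x) ∧ C.coc q (ι x) = D.coc (f q) (ι x))
    (q : Q) (a : S) : f (C.act q a) = D.act (f q) a ∧ C.coc q a = D.coc (f q) a := by
  revert q
  refine h.gen (fun a => ∀ q, f (C.act q a) = D.act (f q) a ∧ C.coc q a = D.coc (f q) a)
    ?_ ?_ (fun x q => hf q x) ?_ a
  · intro q
    simp only [C.act_one, D.act_one, C.coc_one, D.coc_one, and_self]
  · intro a b ha hb q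
    rw [C.act_mul, D.act_mul, C.coc_mul, D.coc_mul, (hb _).1, (hb _).2, (ha _).1, (ha _).2]
    exact ⟨rfl, rfl⟩
  · intro _ x b hxb hbx q
    have hq : C.act (C.act q b) (ι x) = q := by rw [← C.act_mul, hbx, C.act_one]
    have hfq : f (C.act q b) = D.act (f q) b := by
      rw [← D.act_one (f (C.act q b)), ← hxb, D.act_mul, ← (hf _ x).1, hq]
    refine ⟨hfq, left_inv_eq_right_inv (a := C.coc (C.act q b) (ι x)) ?_ ?_⟩
    · rw [← C.coc_mul, hbx, C.coc_one]
    · rw [(hf _ x).2, ← D.act_one (f q), ← hbx, D.act_mul, ← hfq, ← D.coc_mul, hxb, D.coc_one]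

theorem LeftCocycle.hom_of_gen (h : Presents G r ι) {Q Q' M : Type*} [Monoid M]
    (C : LeftCocycle S Q M) (D : LeftCocycle S Q' M) (f : Q → Q')
    (hf : ∀ x q, f (C.act (ι x) q) = D.act (ι x) (f q) ∧ C.coc (ι x) q = D.coc (ι x) (f q))
    (a : S) (q : Q) : f (C.act a q) = D.act a (f q) ∧ C.coc a q = D.coc a (f q) := by
  revert q
  refine h.gen (fun a => ∀ q, f (C.act a q) = D.act a (f q) ∧ C.coc a q = D.coc a (f q))
    ?_ ?_ hf ?_ a
  · intro q
    simp only [C.one_act, D.one_act, C.one_coc, D.one_coc, and_self]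
  · intro a b ha hb q
    rw [C.mul_act, D.mul_act, C.mul_coc, D.mul_coc, (ha _).1, (ha _).2, (hb _).1, (hb _).2]
    exact ⟨rfl, rfl⟩
  · intro _ x b hxb hbx q
    have hq : C.act (ι x) (C.act b q) = q := by rw [← C.mul_act, hxb, C.one_act]
    have hfq : f (C.act b q) = D.act b (f q) := by
      rw [← D.one_act (f (C.act b q)), ← hbx, D.mul_act, ← (hf x _).1, hq]
    refine ⟨hfq, (left_inv_eq_right_inv (a := C.coc (ι x) (C.act b q)) ?_ ?_).symm⟩
    · rw [(hf x _).2, ← D.one_act (f q), ← hxb, D.mul_act, ← hfq, ← D.mul_coc, hbx, D.one_coc]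
    · rw [← C.mul_coc, hxb, C.one_coc]

theorem isUnit_end_of_bijective {Q : Type*} {f : Function.End Q} (hf : Function.Bijective f) :
    IsUnit f := by
  obtain ⟨g, h1, h2⟩ := Function.bijective_iff_has_inverse.mp hf
  exact ⟨⟨f, g, funext h2, funext h1⟩, rfl⟩

/-- An action with a cocycle is the same as an action on `Q × M` commuting with left multiplication
by `M`, so the universal property can be applied to endomaps of `Q × M`. The assumptions under `G`
make the generators act invertibly. -/
theorem RightCocycle.exists_of_gen (h : Presents G r ι) {Q M : Type u} [Monoid M]
    (ac : Q → X → Q) (co : Q → X → M)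
    (hac : ∀ q x y, ac (ac q x) y = ac (ac q (lact r x y)) (ract r x y))
    (hco : ∀ q x y, co q x * co (ac q x) y =
      co q (lact r x y) * co (ac q (lact r x y)) (ract r x y))
    (hbij : G → ∀ x, Function.Bijective fun q => ac q x) (hunit : G → ∀ q x, IsUnit (co q x)) :
    ∃ C : RightCocycle S Q M, ∀ q x, C.act q (ι x) = ac q x ∧ C.coc q (ι x) = co q x := by
  -- The opposite monoid turns a right action into a homomorphism.
  let F : X → (Function.End (Q × M))ᵐᵒᵖ :=
    fun x => .op fun p => (ac p.1 x, p.2 * co p.1 x)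
  obtain ⟨φ, hφ⟩ := h.lift F
    (fun x y => MulOpposite.unop_injective <| funext fun p => Prod.ext (hac p.1 x y) (by
      change p.2 * co p.1 x * co (ac p.1 x) y = p.2 * co p.1 _ * co (ac p.1 _) _
      rw [mul_assoc, hco, mul_assoc]))
    (fun hG x => by
      refine (isUnit_end_of_bijective ⟨?_, ?_⟩).op
      · rintro ⟨q, m⟩ ⟨q', m'⟩ he
        obtain rfl := (hbij hG x).1 (congrArg Prod.fst he)
        obtain rfl := (hunit hG q x).mul_left_injective (congrArg Prod.snd he)
        rfl
      · rintro ⟨q, m⟩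
        obtain ⟨q, rfl⟩ := (hbij hG x).2 q
        obtain ⟨m, rfl⟩ := (IsUnit.isUnit_iff_mulRight_bijective.mp (hunit hG q x)).2 m
        exact ⟨(q, m), rfl⟩)
  -- Commuting with these translations means that the action is determined by its values at the
  -- pairs `(q, 1)`, from which the new action and cocycle are read off.
  let L : M → Function.End (Q × M) := fun m p => (p.1, m * p.2)
  have hcomm : ∀ a m, (φ a).unop * L m = L m * (φ a).unop := by
    refine h.gen _ ?_ ?_ ?_ ?_
    · intro m
      rw [map_one, MulOpposite.unop_one, one_mul, mul_one]
    · intro a b ha hb m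
      rw [map_mul, MulOpposite.unop_mul, mul_assoc, ha, ← mul_assoc, hb, mul_assoc]
    · intro x m
      rw [hφ]
      exact funext fun p => Prod.ext rfl (mul_assoc _ _ _)
    · intro _ x b hxb hbx m
      have h1 : (φ b).unop * (φ (ι x)).unop = 1 := by
        rw [← MulOpposite.unop_mul, ← map_mul, hxb, map_one, MulOpposite.unop_one]
      have h2 : (φ (ι x)).unop * (φ b).unop = 1 := by
        rw [← MulOpposite.unop_mul, ← map_mul, hbx, map_one, MulOpposite.unop_one]
      have h3 : (φ (ι x)).unop * L m = L m * (φ (ι x)).unop := by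
        rw [hφ]
        exact funext fun p => Prod.ext rfl (mul_assoc _ _ _)
      rw [← mul_one ((φ b).unop * L m), ← h2, mul_assoc, ← mul_assoc (L m), ← h3, ← mul_assoc,
        ← mul_assoc, h1, one_mul]
  have key : ∀ a q m, (φ a).unop (q, m) =
      (((φ a).unop (q, 1)).1, m * ((φ a).unop (q, 1)).2) := fun a q m => by
    have := congrFun (hcomm a m) (q, 1)
    change (φ a).unop (q, m * 1) = _ at this
    rw [mul_one] at this
    exact this
  have hmul : ∀ q a b, (φ (a * b)).unop (q, 1) = (φ b).unop ((φ a).unop (q, 1)) := fun q a b => by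
    rw [map_mul]; rfl
  refine ⟨⟨fun q a => ((φ a).unop (q, 1)).1, fun q a => ((φ a).unop (q, 1)).2,
    fun q => ?_, fun q a b => ?_, fun q => ?_, fun q a b => ?_⟩, fun q x => ?_⟩
  · rw [map_one]; rfl
  · rw [hmul, ← Prod.mk.eta (p := (φ a).unop (q, 1)), key]
  · rw [map_one]; rfl
  · rw [hmul, ← Prod.mk.eta (p := (φ a).unop (q, 1)), key]
  · simp only [hφ]
    exact ⟨rfl, one_mul _⟩

theorem LeftCocycle.exists_of_gen (h : Presents G r ι) {Q M : Type u} [Monoid M]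
    (ac : X → Q → Q) (co : X → Q → M)
    (hac : ∀ x y q, ac x (ac y q) = ac (lact r x y) (ac (ract r x y) q))
    (hco : ∀ x y q, co x (ac y q) * co y q =
      co (lact r x y) (ac (ract r x y) q) * co (ract r x y) q)
    (hbij : G → ∀ x, Function.Bijective (ac x)) (hunit : G → ∀ x q, IsUnit (co x q)) :
    ∃ C : LeftCocycle S Q M, ∀ x q, C.act (ι x) q = ac x q ∧ C.coc (ι x) q = co x q := by
  let F : X → Function.End (Q × M) := fun x p => (ac x p.1, co x p.1 * p.2)
  obtain ⟨φ, hφ⟩ := h.lift F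
    (fun x y => funext fun p => Prod.ext (hac x y p.1) (by
      change co x (ac y p.1) * (co y p.1 * p.2) = co _ (ac _ p.1) * (co _ p.1 * p.2)
      rw [← mul_assoc, hco, mul_assoc]))
    (fun hG x => by
      refine isUnit_end_of_bijective ⟨?_, ?_⟩
      · rintro ⟨q, m⟩ ⟨q', m'⟩ he
        obtain rfl := (hbij hG x).1 (congrArg Prod.fst he)
        obtain rfl := (hunit hG x q).mul_right_injective (congrArg Prod.snd he)
        rfl
      · rintro ⟨q, m⟩
        obtain ⟨q, rfl⟩ := (hbij hG x).2 q
        obtain ⟨m, rfl⟩ := (IsUnit.isUnit_iff_mulLeft_bijective.mp (hunit hG x q)).2 m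
        exact ⟨(q, m), rfl⟩)
  let L : M → Function.End (Q × M) := fun m p => (p.1, p.2 * m)
  have hcomm : ∀ a m, φ a * L m = L m * φ a := by
    refine h.gen _ ?_ ?_ ?_ ?_
    · intro m
      rw [map_one, one_mul, mul_one]
    · intro a b ha hb m
      rw [map_mul, mul_assoc, hb, ← mul_assoc, ha, mul_assoc]
    · intro x m
      rw [hφ]
      exact funext fun p => Prod.ext rfl (mul_assoc _ _ _).symm
    · intro _ x b hxb hbx m
      have h1 : φ b * φ (ι x) = 1 := by rw [← map_mul, hbx, map_one]
      have h2 : φ (ι x) * φ b = 1 := by rw [← map_mul, hxb, map_one]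
      have h3 : φ (ι x) * L m = L m * φ (ι x) := by
        rw [hφ]
        exact funext fun p => Prod.ext rfl (mul_assoc _ _ _).symm
      rw [← mul_one (φ b * L m), ← h2, mul_assoc, ← mul_assoc (L m), ← h3, ← mul_assoc,
        ← mul_assoc, h1, one_mul]
  have key : ∀ a q m, φ a (q, m) = ((φ a (q, 1)).1, (φ a (q, 1)).2 * m) := fun a q m => by
    have := congrFun (hcomm a m) (q, 1)
    change φ a (q, 1 * m) = _ at this
    rw [one_mul] at this
    exact this
  have hmul : ∀ q a b, φ (a * b) (q, 1) = φ a (φ b (q, 1)) := fun q a b => by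
    rw [map_mul]; rfl
  refine ⟨⟨fun a q => (φ a (q, 1)).1, fun a q => (φ a (q, 1)).2,
    fun q => ?_, fun a b q => ?_, fun q => ?_, fun a b q => ?_⟩, fun x q => ?_⟩
  · rw [map_one]; rfl
  · rw [hmul, ← Prod.mk.eta (p := φ b (q, 1)), key]
  · rw [map_one]; rfl
  · rw [hmul, ← Prod.mk.eta (p := φ b (q, 1)), key]
  · simp only [hφ]
    exact ⟨rfl, mul_one _⟩

end Cocycle

end QuadraticSet

/-! ### Matched pairs extending ground actions -/

namespace QuadraticSet

universe u

/-- Compatibility of the maps `l : B → A → A`, `ρ : B → A → B` with a quadratic set `A`: the braid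
relation on `B × A × A`. -/
def RightCompat {A B : Type*} (r : A × A → A × A) (l : B → A → A) (ρ : B → A → B) : Prop :=
  ∀ β x y, r (l β x, l (ρ β x) y) = (l β (lact r x y), l (ρ β (lact r x y)) (ract r x y)) ∧
    ρ (ρ β x) y = ρ (ρ β (lact r x y)) (ract r x y)

/-- Compatibility of the maps `l : B → A → A`, `ρ : B → A → B` with a quadratic set `B`: the braid
relation on `B × B × A`. -/
def LeftCompat {A B : Type*} (r : B × B → B × B) (l : B → A → A) (ρ : B → A → B) : Prop :=
  ∀ α β x, r (ρ α (l β x), ρ β x) =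
      (ρ (lact r α β) (l (ract r α β) x), ρ (ract r α β) x) ∧
    l α (l β x) = l (lact r α β) (l (ract r α β) x)

/-- The maps `l`, `ρ` define a bijection `B × A → A × B` which satisfies the mixed braid relations,
and is non-degenerate if `G` holds. -/
structure GroundActions (G : Prop) {A B : Type*} (r : A × A → A × A) (s : B × B → B × B)
    (l : B → A → A) (ρ : B → A → B) : Prop where
  right : RightCompat r l ρ
  left : LeftCompat s l ρ
  bijective_l : G → ∀ β, Function.Bijective (l β)
  bijective_ρ : G → ∀ x, Function.Bijective fun β => ρ β x
  bijective : Function.Bijective fun p : B × A => (l p.1 p.2, ρ p.1 p.2)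

/-- The matched pair `P` extends the maps `l`, `ρ`. -/
def MatchedPair.ExtendsMaps {A B S T : Type*} [Monoid S] [Monoid T] (P : MatchedPair S T)
    (ι : A → S) (κ : B → T) (l : B → A → A) (ρ : B → A → B) : Prop :=
  ∀ β x, P.lact (κ β) (ι x) = ι (l β x) ∧ P.ract (κ β) (ι x) = κ (ρ β x)

section MatchedPair

variable {G : Prop} {A B S T : Type u} [Monoid S] [Monoid T] {r : A × A → A × A}
  {s : B × B → B × B} {ι : A → S} {κ : B → T} {l : B → A → A} {ρ : B → A → B}

theorem RightCompat.exists_rightCocycle (hS : Presents G r ι) (hr : RightCompat r l ρ)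
    (hbij : G → ∀ x, Function.Bijective fun β => ρ β x) :
    ∃ C : RightCocycle S B S, ∀ β x, C.act β (ι x) = ρ β x ∧ C.coc β (ι x) = ι (l β x) := by
  refine RightCocycle.exists_of_gen hS ρ (fun β x => ι (l β x)) (fun β x y => (hr β x y).2)
    (fun β x y => ?_) hbij (fun hG _ _ => hS.unit hG _)
  rw [hS.rel (l β x), lact, ract, (hr β x y).1]

theorem LeftCompat.exists_leftCocycle (hT : Presents G s κ) (hs : LeftCompat s l ρ)
    (hbij : G → ∀ β, Function.Bijective (l β)) :
    ∃ C : LeftCocycle T A T, ∀ β x, C.act (κ β) x = l β x ∧ C.coc (κ β) x = κ (ρ β x) := by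
  refine LeftCocycle.exists_of_gen hT l (fun β x => κ (ρ β x)) (fun α β x => (hs α β x).2)
    (fun α β x => ?_) hbij (fun hG _ _ => hT.unit hG _)
  rw [hT.rel (ρ α (l β x)), lact, ract, (hs α β x).1]

/-- The composite of two cocycles, the second one acting first. -/
def RightCocycle.comp {Q Q' M : Type*} [Monoid M] (C : RightCocycle S Q M)
    (D : RightCocycle S Q' S) : RightCocycle S (Q × Q') M where
  act q a := (C.act q.1 (D.coc q.2 a), D.act q.2 a)
  coc q a := C.coc q.1 (D.coc q.2 a)
  act_one q := by simp only [D.coc_one, D.act_one, C.act_one]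
  act_mul q a b := by simp only [D.coc_mul, D.act_mul, C.act_mul]
  coc_one q := by simp only [D.coc_one, C.coc_one]
  coc_mul q a b := by simp only [D.coc_mul, C.coc_mul]

/-- The composite of two cocycles, the second one acting first. -/
def LeftCocycle.comp {Q Q' M : Type*} [Monoid M] (C : LeftCocycle T Q' M)
    (D : LeftCocycle T Q T) : LeftCocycle T (Q × Q') M where
  act a q := (D.act a q.1, C.act (D.coc a q.1) q.2)
  coc a q := C.coc (D.coc a q.1) q.2
  one_act q := by simp only [D.one_coc, D.one_act, C.one_act]
  mul_act a b q := by simp only [D.mul_coc, D.mul_act, C.mul_act]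
  one_coc q := by simp only [D.one_coc, C.one_coc]
  mul_coc a b q := by simp only [D.mul_coc, C.mul_coc]

/-- The cocycle of a right action given by the identity of `S`. -/
def RightCocycle.self {Q M : Type*} [Monoid M] (C : RightCocycle S Q M) : RightCocycle S Q S where
  act := C.act
  coc _ a := a
  act_one := C.act_one
  act_mul := C.act_mul
  coc_one _ := rfl
  coc_mul _ _ _ := rfl

/-- The diagonal of `B` is a morphism from `C` with tautological cocycle `a ↦ a` to the composite of
`C'` and `C`; comparing the cocycles gives the claim. -/
theorem RightCocycle.leftInverse_coc (hS : Presents G r ι) {l' : B → A → A} {ρ' : B → A → B}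
    (C C' : RightCocycle S B S)
    (hC : ∀ β x, C.act β (ι x) = ρ β x ∧ C.coc β (ι x) = ι (l β x))
    (hC' : ∀ β x, C'.act β (ι x) = ρ' β x ∧ C'.coc β (ι x) = ι (l' β x))
    (hl : ∀ β x, l' β (l β x) = x) (hρ : ∀ β x, ρ' β (l β x) = ρ β x) (β : B) (a : S) :
    C'.coc β (C.coc β a) = a := by
  refine (RightCocycle.hom_of_gen hS C.self (C'.comp C) (fun β => (β, β)) (fun β x => ?_) β a).2.symm
  simp only [self, comp, (hC β x).1, (hC β x).2, (hC' β _).1, (hC' β _).2, hl, hρ, and_self]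

/-- The same braid relation, read from its output back to its input. -/
theorem RightCompat.inverse (hr : RightCompat r l ρ) {l' : B → A → A}
    (h1 : ∀ β x, l' β (l β x) = x) (h2 : ∀ β x, l β (l' β x) = x) :
    RightCompat r l' (fun β x => ρ β (l' β x)) := by
  intro β x y
  set x₁ := l' β x with hx₁
  set t := ρ β x₁ with ht
  set y₁ := l' t y with hy₁
  have hx : x = l β x₁ := (h2 _ _).symm
  have hy : y = l t y₁ := (h2 _ _).symm
  have key := hr β x₁ y₁
  rw [← ht, ← hx, ← hy] at key
  have hl : lact r x y = l β (lact r x₁ y₁) := congrArg Prod.fst key.1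
  have hr' : ract r x y = l (ρ β (lact r x₁ y₁)) (ract r x₁ y₁) := congrArg Prod.snd key.1
  simp only
  rw [hl, hr', h1, h1]
  exact ⟨rfl, key.2⟩

theorem GroundActions.bijective_coc (hS : Presents G r ι) (h : GroundActions G r s l ρ) (hG : G)
    (C : RightCocycle S B S)
    (hC : ∀ β x, C.act β (ι x) = ρ β x ∧ C.coc β (ι x) = ι (l β x)) (β : B) :
    Function.Bijective (C.coc β) := by
  let l' : B → A → A := fun β => (Equiv.ofBijective _ (h.bijective_l hG β)).symm
  have h1 : ∀ β x, l' β (l β x) = x :=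
    fun β => (Equiv.ofBijective _ (h.bijective_l hG β)).symm_apply_apply
  have h2 : ∀ β x, l β (l' β x) = x :=
    fun β => (Equiv.ofBijective _ (h.bijective_l hG β)).apply_symm_apply
  -- For fixed `z`, the map `β ↦ ρ β (l' β z)` is the ground bijection restricted to the fibre where
  -- the first component is `z`; this is where `h.bijective` enters.
  obtain ⟨C', hC'⟩ := (h.right.inverse h1 h2).exists_rightCocycle hS (fun _ z => by
    refine ⟨fun β γ hβγ => ?_, fun β => ?_⟩
    · exact congrArg Prod.fst (@h.bijective.1 (β, l' β z) (γ, l' γ z)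
        (Prod.ext ((h2 β z).trans (h2 γ z).symm) hβγ))
    · obtain ⟨⟨γ, x⟩, hγ⟩ := h.bijective.2 (z, β)
      obtain ⟨rfl, rfl⟩ := Prod.ext_iff.mp hγ
      exact ⟨γ, congrArg (ρ γ) (h1 γ x)⟩)
  refine Function.bijective_iff_has_inverse.mpr ⟨C'.coc β, ?_, ?_⟩
  · exact RightCocycle.leftInverse_coc hS C C' hC hC' h1 (fun β x => by simp only [h1]) β
  · exact RightCocycle.leftInverse_coc hS C' C hC' hC h2 (fun β x => rfl) β

/-- Two passes: words of `S` against single elements of `B`, then words of `T` against whole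
elements of `S`. For groups the second pass needs the maps `C.coc β` to be invertible, which
`GroundActions.bijective_coc` provides. -/
theorem GroundActions.exists_matchedPair (hS : Presents G r ι) (hT : Presents G s κ)
    (h : GroundActions G r s l ρ) : ∃ P : MatchedPair S T, P.ExtendsMaps ι κ l ρ := by
  obtain ⟨C, hC⟩ := h.right.exists_rightCocycle hS h.bijective_ρ
  have hbij : G → ∀ β, Function.Bijective (C.coc β) := fun hG => h.bijective_coc hS hG C hC
  -- The map `s` is an endomorphism of the composite cocycle on `B × B`. Hence the maps `C.coc β`
  -- satisfy the relations of `T`.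
  have hcomp : ∀ (α β : B) (a : S),
      s (C.act α (C.coc β a), C.act β a) = (C.act (lact s α β) (C.coc (ract s α β) a),
        C.act (ract s α β) a) ∧
      C.coc α (C.coc β a) = C.coc (lact s α β) (C.coc (ract s α β) a) := fun α β a => by
    refine RightCocycle.hom_of_gen hS (C.comp C) (C.comp C) s (fun q x => ?_) (α, β) a
    obtain ⟨α, β⟩ := q
    have := h.left α β x
    simp only [RightCocycle.comp, (hC _ _).1, (hC _ _).2]
    exact ⟨this.1, congrArg ι this.2⟩
  obtain ⟨E, hE⟩ := LeftCocycle.exists_of_gen hT (fun β a => C.coc β a) (fun β a => κ (C.act β a))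
    (fun α β a => (hcomp α β a).2)
    (fun α β a => by
      rw [hT.rel (C.act α _), lact, ract, (hcomp α β a).1]) hbij
    (fun hG _ _ => hT.unit hG _)
  -- The laws for a unit and for a product in `S` say that `1 : Unit → S` and the multiplication `S
  -- × S → S` are morphisms of left cocycles, so generators of `T` suffice.
  have hone := LeftCocycle.hom_of_gen hT
    (⟨fun _ q => q, fun u _ => u, fun _ => rfl, fun _ _ _ => rfl, fun _ => rfl, fun _ _ _ => rfl⟩ :
      LeftCocycle T Unit T) E (fun _ => 1)
    (fun β _ => by rw [(hE β 1).1, (hE β 1).2, C.coc_one, C.act_one]; exact ⟨rfl, rfl⟩)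
  have hmul := LeftCocycle.hom_of_gen hT (E.comp E) E (fun p => p.1 * p.2)
    (fun β p => by
      simp only [LeftCocycle.comp, (hE _ _).1, (hE _ _).2, C.coc_mul, C.act_mul, and_self])
  refine ⟨⟨E.act, E.coc, fun u => (hone u ()).1.symm, E.one_act, E.one_coc,
    fun u => (hone u ()).2.symm, E.mul_act, fun u a b => (hmul u (a, b)).2.symm,
    fun u a b => (hmul u (a, b)).1.symm, E.mul_coc⟩, fun β x => ?_⟩
  simp only [(hE _ _).1, (hE _ _).2, (hC _ _).1, (hC _ _).2, and_self]

/-! ### Naturality -/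

variable {P : MatchedPair S T}

theorem MatchedPair.exists_rightCocycle (hS : Presents G r ι) (h : GroundActions G r s l ρ)
    (hP : P.ExtendsMaps ι κ l ρ) :
    ∃ C : RightCocycle S B S, (∀ β x, C.act β (ι x) = ρ β x ∧ C.coc β (ι x) = ι (l β x)) ∧
      ∀ β a, κ (C.act β a) = P.ract (κ β) a ∧ C.coc β a = P.lact (κ β) a := by
  obtain ⟨C, hC⟩ := h.right.exists_rightCocycle hS h.bijective_ρ
  refine ⟨C, hC, RightCocycle.hom_of_gen hS C
    ⟨P.ract, P.lact, P.ract_one, P.ract_mul, P.lact_one, P.lact_mul⟩ κ (fun β x => ?_)⟩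
  rw [(hC β x).1, (hC β x).2]
  exact ⟨(hP β x).2.symm, (hP β x).1.symm⟩

theorem MatchedPair.exists_leftCocycle (hT : Presents G s κ) (h : GroundActions G r s l ρ)
    (hP : P.ExtendsMaps ι κ l ρ) :
    ∃ C : LeftCocycle T A T, (∀ β x, C.act (κ β) x = l β x ∧ C.coc (κ β) x = κ (ρ β x)) ∧
      ∀ u x, ι (C.act u x) = P.lact u (ι x) ∧ C.coc u x = P.ract u (ι x) := by
  obtain ⟨C, hC⟩ := h.left.exists_leftCocycle hT h.bijective_l
  refine ⟨C, hC, LeftCocycle.hom_of_gen hT C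
    ⟨P.lact, P.ract, P.one_lact, P.mul_lact, P.one_ract, P.mul_ract⟩ ι (fun β x => ?_)⟩
  rw [(hC β x).1, (hC β x).2]
  exact ⟨(hP β x).1.symm, (hP β x).2.symm⟩

/-- Naturality; with identity homomorphisms it is uniqueness, and with `i`, `j` it computes `r_U` on
the images of `S` and `T`. -/
theorem MatchedPair.map_hom (hS : Presents G r ι) (hT : Presents G s κ)
    (h : GroundActions G r s l ρ) (hP : P.ExtendsMaps ι κ l ρ) {S' T' : Type*} [Monoid S']
    [Monoid T'] (P' : MatchedPair S' T') (i : S →* S') (j : T →* T')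
    (hP' : P'.ExtendsMaps (i ∘ ι) (j ∘ κ) l ρ) (u : T) (a : S) :
    i (P.lact u a) = P'.lact (j u) (i a) ∧ j (P.ract u a) = P'.ract (j u) (i a) := by
  obtain ⟨C, hC, hC'⟩ := P.exists_rightCocycle hS h hP
  have key := RightCocycle.hom_of_gen hS
    (⟨C.act, fun β a => i (C.coc β a), C.act_one, C.act_mul, fun q => by rw [C.coc_one, map_one],
      fun q a b => by rw [C.coc_mul, map_mul]⟩ : RightCocycle S B S')
    (⟨fun u a => P'.ract u (i a), fun u a => P'.lact u (i a),
      fun q => by rw [map_one, P'.ract_one], fun q a b => by rw [map_mul, P'.ract_mul],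
      fun q => by rw [map_one, P'.lact_one], fun q a b => by rw [map_mul, P'.lact_mul]⟩ :
      RightCocycle S T' S') (j ∘ κ)
    (fun β x => by
      simp only [(hC _ _).1, (hC _ _).2]
      exact ⟨(hP' β x).2.symm, (hP' β x).1.symm⟩)
  refine LeftCocycle.hom_of_gen hT
    (⟨P.lact, fun u a => j (P.ract u a), P.one_lact, P.mul_lact,
      fun q => by rw [P.one_ract, map_one], fun u v q => by rw [P.mul_ract, map_mul]⟩ :
      LeftCocycle T S T')
    (⟨fun u a => P'.lact (j u) a, fun u a => P'.ract (j u) a,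
      fun q => by rw [map_one, P'.one_lact], fun u v q => by rw [map_mul, P'.mul_lact],
      fun q => by rw [map_one, P'.one_ract], fun u v q => by rw [map_mul, P'.mul_ract]⟩ :
      LeftCocycle T S' T') i
    (fun β a => ⟨?_, ?_⟩) u a
  · exact (congrArg i (hC' β a).2).symm.trans (key β a).2
  · exact (congrArg j (hC' β a).1).symm.trans (key β a).1

theorem MatchedPair.eq_of_extendsMaps (hS : Presents G r ι) (hT : Presents G s κ)
    (h : GroundActions G r s l ρ) (hP : P.ExtendsMaps ι κ l ρ) {P' : MatchedPair S T}
    (hP' : P'.ExtendsMaps ι κ l ρ) : P' = P := by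
  have key := P.map_hom hS hT h hP P' (MonoidHom.id S) (MonoidHom.id T) hP'
  obtain ⟨L, R⟩ := P
  obtain ⟨L', R'⟩ := P'
  obtain rfl : L = L' := funext₂ fun u a => (key u a).1
  obtain rfl : R = R' := funext₂ fun u a => (key u a).2
  rfl

/-- With both homomorphisms the identity, this gives `ᵘv uᵛ = u v` in a braided monoid. -/
theorem MatchedPair.hom_mul_hom (hS : Presents G r ι) (hT : Presents G s κ)
    (h : GroundActions G r s l ρ) (hP : P.ExtendsMaps ι κ l ρ) {U : Type*} [Monoid U]
    (i : S →* U) (j : T →* U) (hij : ∀ β x, j (κ β) * i (ι x) = i (ι (l β x)) * j (κ (ρ β x)))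
    (u : T) (a : S) : j u * i a = i (P.lact u a) * j (P.ract u a) := by
  obtain ⟨C, hC, hC'⟩ := P.exists_rightCocycle hS h hP
  have key : ∀ a β, j (κ β) * i a = i (C.coc β a) * j (κ (C.act β a)) := by
    refine hS.gen _ (fun β => ?_) (fun a b ha hb β => ?_) (fun x β => ?_)
      (fun _ x b hxb hbx β => ?_)
    · rw [C.act_one, C.coc_one, map_one, mul_one, one_mul]
    · rw [C.act_mul, C.coc_mul, map_mul, map_mul, ← mul_assoc, ha, mul_assoc, hb, mul_assoc]
    · rw [(hC β x).1, (hC β x).2, hij]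
    · have hβ : C.act (C.act β b) (ι x) = β := by rw [← C.act_mul, hbx, C.act_one]
      have := hij (C.act β b) x
      rw [← (hC _ _).1, ← (hC _ _).2, hβ] at this
      rw [← mul_one (j (κ (C.act β b))), ← map_one i, ← hxb, map_mul, ← mul_assoc (j _), this,
        ← mul_assoc, ← mul_assoc, ← map_mul, ← C.coc_mul, hbx, C.coc_one, map_one, one_mul]
  revert a
  refine hT.gen (fun u => ∀ a, j u * i a = i (P.lact u a) * j (P.ract u a))
    (fun a => ?_) (fun u v hu hv a => ?_) (fun β a => ?_) (fun _ β v hβv hvβ a => ?_) u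
  · rw [P.one_lact, P.one_ract, map_one, mul_one, one_mul]
  · rw [P.mul_lact, P.mul_ract, map_mul, map_mul, mul_assoc, hv, ← mul_assoc, hu, mul_assoc]
  · rw [key, (hC' β a).1, (hC' β a).2]
  · have ha : P.lact (κ β) (P.lact v a) = a := by rw [← P.mul_lact, hβv, P.one_lact]
    have := key (P.lact v a) β
    rw [(hC' _ _).1, (hC' _ _).2, ha] at this
    rw [← mul_one (j v * i a), ← map_one j, ← P.one_ract a, ← hβv, P.mul_ract, map_mul,
      ← mul_assoc, mul_assoc (j v), ← this, ← mul_assoc, ← map_mul, hvβ, map_one, one_mul]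

end MatchedPair

end QuadraticSet

/-! ### Bijectivity of the map of a matched pair -/

namespace QuadraticSet

universe u

theorem MatchedPair.bijective_map_of_isUnit {S T : Type*} [Monoid S] [Monoid T]
    (P : MatchedPair S T) (hS : ∀ a : S, IsUnit a) (hT : ∀ u : T, IsUnit u) :
    Function.Bijective P.map := by
  have hS' : ∀ a : S, ∃ b, a * b = 1 ∧ b * a = 1 :=
    fun a => ⟨_, (hS a).mul_val_inv, (hS a).val_inv_mul⟩
  have hT' : ∀ a : T, ∃ b, a * b = 1 ∧ b * a = 1 :=
    fun a => ⟨_, (hT a).mul_val_inv, (hT a).val_inv_mul⟩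
  choose iS hS1 hS2 using hS'
  choose iT hT1 hT2 using hT'
  -- The formula is suggested by the product group: `u a = b v` means `a⁻¹ u⁻¹ = v⁻¹ b⁻¹`, so `a⁻¹`
  -- and `u⁻¹` are the results of letting `v⁻¹` and `b⁻¹` act on each other.
  refine Function.bijective_iff_has_inverse.mpr
    ⟨fun p => (iT (P.ract (iT p.2) (iS p.1)), iS (P.lact (iT p.2) (iS p.1))), ?_, ?_⟩
  · rintro ⟨u, a⟩
    have hu : iT (P.ract u a) = P.ract (iT u) (P.lact u a) := by
      refine left_inv_eq_right_inv (hT2 _) ?_ |>.symm ▸ rfl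
      have : P.ract u a = P.ract u (P.lact (iT u) (P.lact u a)) := by
        rw [← P.mul_lact, hT2, P.one_lact]
      rw [this, ← P.mul_ract, hT1, P.one_ract]
    have hq : P.ract (iT (P.ract u a)) (iS (P.lact u a)) = iT u := by
      rw [hu, ← P.ract_mul, hS1, P.ract_one]
    have hp : a * P.lact (iT (P.ract u a)) (iS (P.lact u a)) = 1 := by
      have : a = P.lact (iT u) (P.lact u a) := by rw [← P.mul_lact, hT2, P.one_lact]
      nth_rewrite 1 [this]
      rw [hu, ← P.lact_mul, hS1, P.lact_one]
    refine Prod.ext ?_ ?_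
    · change iT (P.ract (iT (P.ract u a)) (iS (P.lact u a))) = u
      rw [hq]
      exact left_inv_eq_right_inv (hT2 _) (hT2 _)
    · exact (left_inv_eq_right_inv hp (hS1 _)).symm
  · rintro ⟨b, v⟩
    set p := P.lact (iT v) (iS b) with hp
    set q := P.ract (iT v) (iS b) with hq
    have hqb : iS p = P.lact q b := by
      refine left_inv_eq_right_inv (hS2 p) ?_
      rw [hp, hq, ← P.lact_mul, hS2, P.lact_one]
    have hqv : P.ract q b = iT v := by rw [hq, ← P.ract_mul, hS2, P.ract_one]
    refine Prod.ext ?_ ?_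
    · change P.lact (iT q) (iS p) = b
      rw [hqb, ← P.mul_lact, hT2, P.one_lact]
    · change P.ract (iT q) (iS p) = v
      refine left_inv_eq_right_inv (a := iT v) ?_ (hT2 v)
      rw [← hqv, hqb, ← P.mul_ract, hT2, P.one_ract]

/-- Inverting the ground bijection exchanges the roles of `A` and `B`, and with them the two mixed
braid relations. Non-degeneracy of the inverse is not claimed, hence `G` is `False`. -/
theorem GroundActions.exists_inverse {A B : Type*} {r : A × A → A × A} {s : B × B → B × B}
    {l : B → A → A} {ρ : B → A → B} (h : GroundActions False r s l ρ) :
    ∃ (l' : A → B → B) (ρ' : A → B → A), GroundActions False s r l' ρ' ∧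
      (∀ β x, l' (l β x) (ρ β x) = β ∧ ρ' (l β x) (ρ β x) = x) ∧
      ∀ x β, l (l' x β) (ρ' x β) = x ∧ ρ (l' x β) (ρ' x β) = β := by
  let e := Equiv.ofBijective _ h.bijective
  have h1 : ∀ β x, (e.symm (l β x, ρ β x)).1 = β ∧ (e.symm (l β x, ρ β x)).2 = x :=
    fun β x => Prod.ext_iff.mp (e.symm_apply_apply (β, x))
  have h2 : ∀ x β, l (e.symm (x, β)).1 (e.symm (x, β)).2 = x ∧
      ρ (e.symm (x, β)).1 (e.symm (x, β)).2 = β :=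
    fun x β => Prod.ext_iff.mp (e.apply_symm_apply (x, β))
  obtain ⟨l', hl'⟩ : ∃ l' : A → B → B, ∀ x β, (e.symm (x, β)).1 = l' x β := ⟨_, fun _ _ => rfl⟩
  obtain ⟨ρ', hρ'⟩ : ∃ ρ' : A → B → A, ∀ x β, (e.symm (x, β)).2 = ρ' x β := ⟨_, fun _ _ => rfl⟩
  simp only [hl', hρ'] at h1 h2
  refine ⟨l', ρ', ⟨?_, ?_, False.elim, False.elim, ?_⟩, h1, h2⟩
  · intro x β γ
    have key := h.left (l' x β) (l' (ρ' x β) γ) (ρ' (ρ' x β) γ)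
    rw [(h2 (ρ' x β) γ).1, (h2 (ρ' x β) γ).2, (h2 x β).1, (h2 x β).2] at key
    generalize hL : lact s (l' x β) (l' (ρ' x β) γ) = L at key
    generalize hR : ract s (l' x β) (l' (ρ' x β) γ) = R at key
    have hl : lact s β γ = ρ L (l R (ρ' (ρ' x β) γ)) := congrArg Prod.fst key.1
    have hr : ract s β γ = ρ R (ρ' (ρ' x β) γ) := congrArg Prod.snd key.1
    have e1 : l' x (lact s β γ) = L := by
      rw [hl]; exact (congrArg (fun y => l' y _) key.2).trans (h1 _ _).1
    have e2 : ρ' x (lact s β γ) = l R (ρ' (ρ' x β) γ) := by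
      rw [hl]; exact (congrArg (fun y => ρ' y _) key.2).trans (h1 _ _).2
    rw [e1, e2, hr, (h1 _ _).1, (h1 _ _).2]
    exact ⟨Prod.ext hL hR, rfl⟩
  · intro x y β
    have key := h.right (l' x (l' y β)) (ρ' x (l' y β)) (ρ' y β)
    rw [(h2 x _).1, (h2 x _).2, (h2 y β).1, (h2 y β).2] at key
    generalize hL : lact r (ρ' x (l' y β)) (ρ' y β) = L at key
    generalize hR : ract r (ρ' x (l' y β)) (ρ' y β) = R at key
    have hl : lact r x y = l (l' x (l' y β)) L := congrArg Prod.fst key.1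
    have hr : ract r x y = l (ρ (l' x (l' y β)) L) R := congrArg Prod.snd key.1
    have e1 : l' (ract r x y) β = ρ (l' x (l' y β)) L := by
      rw [hr]; exact (congrArg (l' _) key.2).trans (h1 _ _).1
    have e2 : ρ' (ract r x y) β = R := by
      rw [hr]; exact (congrArg (ρ' _) key.2).trans (h1 _ _).2
    rw [e1, e2, hl, (h1 _ _).1, (h1 _ _).2]
    exact ⟨Prod.ext hL hR, rfl⟩
  · refine Function.bijective_iff_has_inverse.mpr ⟨fun p => (l p.1 p.2, ρ p.1 p.2), ?_, ?_⟩
    · exact fun p => Prod.ext (h2 _ _).1 (h2 _ _).2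
    · exact fun p => Prod.ext (h1 _ _).1 (h1 _ _).2

section

variable {G : Prop} {A B S T : Type u} [Monoid S] [Monoid T] {r : A × A → A × A}
  {s : B × B → B × B} {ι : A → S} {κ : B → T} {l : B → A → A} {ρ : B → A → B}
  {P : MatchedPair S T}

theorem MatchedPair.leftInverse_map (hS : Presents False r ι) (hT : Presents False s κ)
    (h : GroundActions False r s l ρ) (hP : P.ExtendsMaps ι κ l ρ) {l' : A → B → B}
    {ρ' : A → B → A} {P' : MatchedPair T S} (hP' : P'.ExtendsMaps κ ι l' ρ')
    (hinv : ∀ β x, l' (l β x) (ρ β x) = β ∧ ρ' (l β x) (ρ β x) = x) :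
    Function.LeftInverse P'.map P.map := by
  obtain ⟨C, hC, hC'⟩ := P.exists_rightCocycle hS h hP
  have key : ∀ a β, P'.lact (C.coc β a) (κ (C.act β a)) = κ β ∧
      P'.ract (C.coc β a) (κ (C.act β a)) = a := by
    refine hS.gen _ (fun β => ?_) (fun a b ha hb β => ?_) (fun x β => ?_) False.elim
    · rw [C.coc_one, C.act_one, P'.one_lact, P'.one_ract]
      exact ⟨rfl, rfl⟩
    · rw [C.coc_mul, C.act_mul, P'.mul_lact, P'.mul_ract, (hb _).1, (hb _).2, (ha _).1, (ha _).2]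
      exact ⟨rfl, rfl⟩
    · rw [(hC β x).1, (hC β x).2, (hP' _ _).1, (hP' _ _).2, (hinv β x).1, (hinv β x).2]
      exact ⟨rfl, rfl⟩
  suffices ∀ u a, P'.lact (P.lact u a) (P.ract u a) = u ∧ P'.ract (P.lact u a) (P.ract u a) = a
    from fun p => Prod.ext (this p.1 p.2).1 (this p.1 p.2).2
  refine hT.gen _ (fun a => ?_) (fun u v hu hv a => ?_) (fun β a => ?_) False.elim
  · rw [P.one_lact, P.one_ract, P'.lact_one, P'.ract_one]
    exact ⟨rfl, rfl⟩
  · rw [P.mul_lact, P.mul_ract, P'.lact_mul, P'.ract_mul, (hu _).1, (hu _).2, (hv _).1, (hv _).2]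
    exact ⟨rfl, rfl⟩
  · rw [← (hC' β a).1, ← (hC' β a).2]
    exact key a β

/-- For groups any matched pair will do. For monoids the inverse is the map of the matched pair
extending the inverse ground bijection. -/
theorem MatchedPair.bijective_map (hS : Presents G r ι) (hT : Presents G s κ)
    (h : GroundActions G r s l ρ) (hP : P.ExtendsMaps ι κ l ρ) : Function.Bijective P.map := by
  obtain rfl | rfl : G = True ∨ G = False := Classical.propComplete G
  · exact P.bijective_map_of_isUnit (hS.isUnit trivial) (hT.isUnit trivial)
  · obtain ⟨l', ρ', h', h1, h2⟩ := h.exists_inverse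
    obtain ⟨P', hP'⟩ := h'.exists_matchedPair hT hS
    exact Function.bijective_iff_has_inverse.mpr
      ⟨P'.map, leftInverse_map hS hT h hP hP' h1, leftInverse_map hT hS h' hP' hP h2⟩

/-! ### The identities of a generalized strong twisted union -/

/-- The identity is extended one variable at a time: first the element `b` that modifies `β`, then
the element acted upon, then `u`. -/
theorem MatchedPair.lact_ract_of_gen (hS : Presents G r ι) (hT : Presents G s κ)
    (h : GroundActions G r s l ρ) (hP : P.ExtendsMaps ι κ l ρ)
    (hl : ∀ β x y, l (ρ β y) x = l β x) (u : T) (a b : S) :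
    P.lact (P.ract u b) a = P.lact u a := by
  obtain ⟨C, hC, hC'⟩ := P.exists_rightCocycle hS h hP
  have h1 : ∀ b β x, l (C.act β b) x = l β x := by
    refine hS.gen _ (fun β x => by rw [C.act_one]) (fun a b ha hb β x => ?_) (fun y β x => ?_)
      (fun _ y b _ hby β x => ?_)
    · rw [C.act_mul, hb, ha]
    · rw [(hC β y).1, hl]
    · rw [← hl _ x y, ← (hC _ y).1, ← C.act_mul, hby, C.act_one]
  have h2 : ∀ a β b, C.coc (C.act β b) a = C.coc β a := by
    refine hS.gen _ (fun β b => by rw [C.coc_one, C.coc_one]) (fun a a' ha ha' β b => ?_)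
      (fun x β b => ?_) (fun _ x v hxv hvx β b => ?_)
    · rw [C.coc_mul, C.coc_mul, ha, ha', ha', ha']
    · rw [(hC _ x).2, (hC _ x).2, h1]
    -- Both sides are inverse to `C.coc β (ι x)`, so the left side does not depend on `b`; taking `b
    -- = 1` then removes the modification altogether.
    · have hv : ∀ b, C.coc (C.act β b) v = C.coc (C.act β (ι x)) v := fun b => by
        refine left_inv_eq_right_inv (a := C.coc β (ι x)) ?_ ?_
        · have : C.coc β (ι x) = C.coc (C.act (C.act β b) v) (ι x) := by
            rw [(hC _ x).2, (hC _ x).2, h1, h1]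
          rw [this, ← C.coc_mul, hvx, C.coc_one]
        · rw [← C.coc_mul, hxv, C.coc_one]
      rw [hv, ← hv 1, C.act_one]
  have h3 : ∀ β a b, P.lact (P.ract (κ β) b) a = P.lact (κ β) a := fun β a b => by
    rw [← (hC' β b).1, ← (hC' _ a).2, ← (hC' _ a).2, h2]
  revert a b
  refine hT.gen (fun u => ∀ a b, P.lact (P.ract u b) a = P.lact u a) (fun a b => ?_)
    (fun u v hu hv a b => ?_) h3 (fun _ β v hβv hvβ a b => ?_) u
  · rw [P.one_ract]
  · rw [P.mul_ract, P.mul_lact, P.mul_lact, hu, hv]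
  · have : P.lact (κ β) (P.lact (P.ract v b) a) = a := by
      rw [← h3 β _ (P.lact v b), ← P.mul_lact, ← P.mul_ract, hβv, P.one_ract, P.one_lact]
    rw [← P.one_lact (P.lact (P.ract v b) a), ← hvβ, P.mul_lact, this]

theorem MatchedPair.ract_lact_of_gen (hS : Presents G r ι) (hT : Presents G s κ)
    (h : GroundActions G r s l ρ) (hP : P.ExtendsMaps ι κ l ρ)
    (hρ : ∀ β γ x, ρ β (l γ x) = ρ β x) (u v : T) (a : S) :
    P.ract u (P.lact v a) = P.ract u a := by
  obtain ⟨C, hC, hC'⟩ := P.exists_leftCocycle hT h hP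
  have h1 : ∀ v β x, ρ β (C.act v x) = ρ β x := by
    refine hT.gen _ (fun β x => by rw [C.one_act]) (fun a b ha hb β x => ?_) (fun y β x => ?_)
      (fun _ γ v hγv _ β x => ?_)
    · rw [C.mul_act, ha, hb]
    · rw [(hC y x).1, hρ]
    · rw [← hρ β γ, ← (hC γ _).1, ← C.mul_act, hγv, C.one_act]
  have h2 : ∀ u v x, C.coc u (C.act v x) = C.coc u x := by
    refine hT.gen _ (fun v x => by rw [C.one_coc, C.one_coc]) (fun u u' hu hu' v x => ?_)
      (fun β v x => ?_) (fun _ β w hβw hwβ v x => ?_)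
    · rw [C.mul_coc, C.mul_coc, hu, hu', hu, hu]
    · rw [(hC β _).2, (hC β _).2, h1]
    · have hw : ∀ v, C.coc w (C.act v x) = C.coc w (C.act (κ β) x) := fun v => by
        refine (left_inv_eq_right_inv (a := C.coc (κ β) x) ?_ ?_).symm
        · rw [← C.mul_coc, hwβ, C.one_coc]
        · have : C.coc (κ β) x = C.coc (κ β) (C.act w (C.act v x)) := by
            rw [(hC β _).2, (hC β _).2, h1, h1]
          rw [this, ← C.mul_coc, hβw, C.one_coc]
      rw [hw, ← hw 1, C.one_act]
  have h3 : ∀ x u v, P.ract u (P.lact v (ι x)) = P.ract u (ι x) := fun x u v => by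
    rw [← (hC' v x).1, ← (hC' u _).2, ← (hC' u _).2, h2]
  revert u v
  refine hS.gen (fun a => ∀ u v, P.ract u (P.lact v a) = P.ract u a) (fun u v => ?_)
    (fun a b ha hb u v => ?_) h3 (fun _ x b hxb hbx u v => ?_) a
  · rw [P.lact_one]
  · rw [P.lact_mul, P.ract_mul, P.ract_mul, ha, hb]
  · have : P.ract (P.ract u (P.lact v b)) (ι x) = u := by
      rw [← h3 x _ (P.ract v b), ← P.ract_mul, ← P.lact_mul, hbx, P.lact_one, P.ract_one]
    rw [← P.ract_one (P.ract u (P.lact v b)), ← hxb, P.ract_mul, this]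

/-- The set `i(S) j(T)` contains `1` and is stable under left multiplication by `i(S)` and, by
`hij`, by `j(T)`. Inverses of generators lie in these images too. -/
theorem exists_factorization {Z U : Type u} [Monoid U] {t : Z × Z → Z × Z} {ζ : Z → U}
    (hS : Presents G r ι) (hT : Presents G s κ) (hU : Presents G t ζ) (P : MatchedPair S T)
    (i : S →* U) (j : T →* U) (hij : ∀ u a, j u * i a = i (P.lact u a) * j (P.ract u a))
    (hZ : ∀ z, (∃ x, ζ z = i (ι x)) ∨ ∃ β, ζ z = j (κ β)) (w : U) : ∃ a u, w = i a * j u := by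
  have hi : ∀ a w, (∃ b u, w = i b * j u) → ∃ b u, i a * w = i b * j u := by
    rintro a _ ⟨b, u, rfl⟩
    exact ⟨a * b, u, by rw [map_mul, mul_assoc]⟩
  have hj : ∀ v w, (∃ b u, w = i b * j u) → ∃ b u, j v * w = i b * j u := by
    rintro v _ ⟨b, u, rfl⟩
    exact ⟨P.lact v b, P.ract v b * u, by rw [map_mul, ← mul_assoc, hij, mul_assoc]⟩
  have key : ∀ v w, (∃ b u, w = i b * j u) → ∃ b u, v * w = i b * j u := by
    refine hU.gen _ (fun w hw => ?_) (fun v v' hv hv' w hw => ?_) (fun z w hw => ?_)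
      (fun hG z v hzv hvz w hw => ?_)
    · rwa [one_mul]
    · rw [mul_assoc]
      exact hv _ (hv' _ hw)
    · rcases hZ z with ⟨x, hx⟩ | ⟨β, hβ⟩
      · rw [hx]; exact hi _ _ hw
      · rw [hβ]; exact hj _ _ hw
    · rcases hZ z with ⟨x, hx⟩ | ⟨β, hβ⟩
      · rw [left_inv_eq_right_inv (c := i ((hS.unit hG x).unit⁻¹ : Sˣ)) hvz
          (by rw [hx, ← map_mul, IsUnit.mul_val_inv, map_one])]
        exact hi _ _ hw
      · rw [left_inv_eq_right_inv (c := j ((hT.unit hG β).unit⁻¹ : Tˣ)) hvz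
          (by rw [hβ, ← map_mul, IsUnit.mul_val_inv, map_one])]
        exact hj _ _ hw
  have := key w 1 ⟨1, 1, by rw [map_one, map_one, one_mul]⟩
  rwa [mul_one] at this

end

/-! ### Existence and uniqueness of the structure of a braided monoid -/

section

variable {G : Prop} {Z M : Type u} [Monoid M] {r : Z × Z → Z × Z} {ι : Z → M}

/-- The outer components of the braid relation express the action laws applied to `ᵘv uᵛ = u v`, so
only the middle one carries information. -/
theorem MatchedPair.isBraided_map_of_middle (P : MatchedPair M M)
    (hmul : ∀ u v, P.lact u v * P.ract u v = u * v)
    (hmid : ∀ x y z, P.ract (P.lact x y) (P.lact (P.ract x y) z) =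
      P.lact (P.ract x (P.lact y z)) (P.ract y z)) : IsBraided P.map := by
  rintro ⟨x, y, z⟩
  refine Prod.ext ?_ (Prod.ext (hmid x y z) ?_)
  · change P.lact (P.lact x y) (P.lact (P.ract x y) z) = P.lact x (P.lact y z)
    rw [← P.mul_lact, hmul, P.mul_lact]
  · change P.ract (P.ract x y) z = P.ract (P.ract x (P.lact y z)) (P.ract y z)
    rw [← P.ract_mul, ← P.ract_mul, hmul]

/-- Both triples have product `x y z` and the same outer components, which cancel. -/
theorem MatchedPair.middle_of_isUnit (P : MatchedPair M M)
    (hmul : ∀ u v, P.lact u v * P.ract u v = u * v) (hM : ∀ a : M, IsUnit a) (x y z : M) :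
    P.ract (P.lact x y) (P.lact (P.ract x y) z) =
      P.lact (P.ract x (P.lact y z)) (P.ract y z) := by
  refine (hM (P.lact x (P.lact y z))).mul_left_cancel
    ((hM (P.ract (P.ract x y) z)).mul_right_cancel ?_)
  have h1 : P.lact x (P.lact y z) = P.lact (P.lact x y) (P.lact (P.ract x y) z) := by
    rw [← P.mul_lact, ← P.mul_lact, hmul]
  have h2 : P.ract (P.ract x y) z = P.ract (P.ract x (P.lact y z)) (P.ract y z) := by
    rw [← P.ract_mul, ← P.ract_mul, hmul]
  calc _ = x * y * z := by rw [h1, hmul, mul_assoc, hmul, ← mul_assoc, hmul]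
    _ = _ := by
      rw [h2, mul_assoc (P.lact x _), hmul, ← mul_assoc, hmul, mul_assoc x y, mul_assoc x _ _, hmul]

/-- Without cancellation the relation is spread from generators, first in `x`, then in `z`, and last
in `y`. The order matters: while `y` is a generator, the cocycles `C` and `D` keep the elements
obtained from generators inside the generating set, so the inductive hypotheses apply. -/
theorem MatchedPair.middle_of_gen (hM : Presents False r ι)
    (h : GroundActions False r r (QuadraticSet.lact r) (QuadraticSet.ract r)) (hr : IsBraided r)
    {P : MatchedPair M M} (hP : P.ExtendsMaps ι ι (QuadraticSet.lact r) (QuadraticSet.ract r))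
    (hmul : ∀ u v, P.lact u v * P.ract u v = u * v)
    (x y z : M) :
    P.ract (P.lact x y) (P.lact (P.ract x y) z) =
      P.lact (P.ract x (P.lact y z)) (P.ract y z) := by
  obtain ⟨C, -, hC⟩ := P.exists_rightCocycle hM h hP
  obtain ⟨D, -, hD⟩ := P.exists_leftCocycle hM h hP
  have hl : ∀ x y z, P.lact (P.lact x y) (P.lact (P.ract x y) z) = P.lact x (P.lact y z) :=
    fun x y z => by rw [← P.mul_lact, hmul, P.mul_lact]
  have hρ : ∀ x y z, P.ract (P.ract x (P.lact y z)) (P.ract y z) = P.ract (P.ract x y) z :=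
    fun x y z => by rw [← P.ract_mul, hmul, P.ract_mul]
  have h1 : ∀ x y z, P.ract (P.lact x (ι y)) (P.lact (P.ract x (ι y)) (ι z)) =
      P.lact (P.ract x (P.lact (ι y) (ι z))) (P.ract (ι y) (ι z)) := by
    refine hM.gen _ (fun y z => ?_) (fun u v hu hv y z => ?_) (fun x y z => ?_) False.elim
    · rw [P.one_lact, P.one_ract, P.one_lact, P.one_ract, P.one_lact]
    · have := hu (D.act v y) (D.act (P.ract v (ι y)) z)
      rw [(hD _ _).1, (hD _ _).1, hl, hv] at this
      rw [P.mul_lact, P.mul_ract, P.mul_lact, this, P.mul_ract, P.mul_lact]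
    · simp only [(hP _ _).1, (hP _ _).2]
      exact congrArg ι (congrArg (fun p => p.2.1) (hr (x, y, z)))
  have h2 : ∀ z x y, P.ract (P.lact x (ι y)) (P.lact (P.ract x (ι y)) z) =
      P.lact (P.ract x (P.lact (ι y) z)) (P.ract (ι y) z) := by
    refine hM.gen _ (fun x y => ?_) (fun z w hz hw x y => ?_) (fun z x y => h1 x y z) False.elim
    · rw [P.lact_one, P.lact_one, P.ract_one, P.ract_one, P.ract_one]
    · have := hw (P.ract x (P.lact (ι y) z)) (C.act y z)
      rw [(hC _ _).1, hρ] at this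
      rw [P.lact_mul, P.ract_mul, hz, this, P.lact_mul, P.ract_mul, P.ract_mul]
  revert x z
  refine hM.gen (fun y => ∀ x z, P.ract (P.lact x y) (P.lact (P.ract x y) z) =
      P.lact (P.ract x (P.lact y z)) (P.ract y z)) (fun x z => ?_) (fun y w hy hw x z => ?_)
      (fun y x z => h2 z x y) False.elim y
  · rw [P.lact_one, P.one_ract, P.one_ract, P.lact_one]
  · rw [P.lact_mul, P.ract_mul, P.mul_ract, hl, hy, hw, P.mul_lact, P.mul_ract, P.lact_mul, hρ]

theorem GroundActions.exists_braidedMonoid (hM : Presents G r ι)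
    (h : GroundActions G r r (lact r) (ract r)) (hr : IsBraided r) :
    ∃ B : BraidedMonoid M, B.ExtendsMaps ι ι (lact r) (ract r) := by
  obtain ⟨P, hP⟩ := h.exists_matchedPair hM hM
  have hmul : ∀ u v, P.lact u v * P.ract u v = u * v := fun u v =>
    (P.hom_mul_hom hM hM h hP (MonoidHom.id M) (MonoidHom.id M) hM.rel u v).symm
  refine ⟨⟨P, hmul, P.bijective_map hM hM h hP, P.isBraided_map_of_middle hmul ?_⟩, hP⟩
  obtain rfl | rfl : G = True ∨ G = False := Classical.propComplete G
  · exact P.middle_of_isUnit hmul (hM.isUnit trivial)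
  · exact MatchedPair.middle_of_gen hM h hr hP hmul

theorem BraidedMonoid.extends_iff {B : BraidedMonoid M} :
    B.Extends r ι ↔ B.ExtendsMaps ι ι (lact r) (ract r) :=
  forall₂_congr fun _ _ => Prod.ext_iff

theorem BraidedMonoid.isAssociated (hM : Presents G r ι)
    (h : GroundActions G r r (lact r) (ract r)) {B : BraidedMonoid M}
    (hB : B.ExtendsMaps ι ι (lact r) (ract r)) : B.IsAssociated r ι := by
  refine ⟨extends_iff.mpr hB, fun B' hB' => ?_⟩
  have := MatchedPair.eq_of_extendsMaps hM hM h hB (extends_iff.mp hB')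
  obtain ⟨P, _, _, _⟩ := B
  obtain ⟨P', _, _, _⟩ := B'
  obtain rfl : P' = P := this
  rfl

end

end QuadraticSet

/-! ### Ground actions between invariant subsets -/

namespace QuadraticSet

universe u

theorem IsBraided.rightCompat {Z : Type*} {r : Z × Z → Z × Z} (hr : IsBraided r) :
    RightCompat r (lact r) (ract r) := fun β x y => by
  have := hr (β, x, y)
  exact ⟨Prod.ext (congrArg (fun p => p.1) this) (congrArg (fun p => p.2.1) this),
    congrArg (fun p => p.2.2) this⟩

theorem IsBraided.leftCompat {Z : Type*} {r : Z × Z → Z × Z} (hr : IsBraided r) :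
    LeftCompat r (lact r) (ract r) := fun α β x => by
  have := (hr (α, β, x)).symm
  exact ⟨Prod.ext (congrArg (fun p => p.2.1) this) (congrArg (fun p => p.2.2) this),
    congrArg (fun p => p.1) this⟩

section

variable {Z : Type u} {r : Equiv.Perm (Z × Z)}

theorem GroundActions.of_isBraided (hr : IsBraided r) (hn : Nondegenerate r) (G : Prop) :
    GroundActions G r r (lact r) (ract r) where
  right := hr.rightCompat
  left := hr.leftCompat
  bijective_l _ x := (hn x).1
  bijective_ρ _ x := (hn x).2
  bijective := r.bijective

theorem IsBraided.induced (hr : IsBraided r) {X : Set Z} (hX : IsInvariant r X) :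
    IsBraided (induced r hX) := fun p => by
  have := hr (p.1.1, p.2.1.1, p.2.2.1)
  exact Prod.ext (Subtype.ext (congrArg (fun p => p.1) this))
    (Prod.ext (Subtype.ext (congrArg (fun p => p.2.1) this))
      (Subtype.ext (congrArg (fun p => p.2.2) this)))

/-- Injectivity is inherited from `Z`; `hl`, `hρ` and `hbij` ensure that preimages of elements of
the subsets stay in the subsets, which gives surjectivity. -/
theorem GroundActions.restrict (hr : IsBraided r) (hn : Nondegenerate r) (G : Prop) {A B : Set Z}
    (hA : IsInvariant r A) (hB : IsInvariant r B)
    (hBA : ∀ β ∈ B, ∀ x ∈ A, lact r β x ∈ A ∧ ract r β x ∈ B)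
    (hl : ∀ β ∈ B, ∀ x, lact r β x ∈ A → x ∈ A) (hρ : ∀ x ∈ A, ∀ β, ract r β x ∈ B → β ∈ B)
    (hbij : ∀ β x, lact r β x ∈ A → ract r β x ∈ B → β ∈ B ∧ x ∈ A) :
    GroundActions G (induced r hA) (induced r hB)
      (fun β x => ⟨lact r β x, (hBA β β.2 x x.2).1⟩)
      (fun β x => ⟨ract r β x, (hBA β β.2 x x.2).2⟩) where
  right β x y := by
    have := hr.rightCompat β x y
    have h1 := Prod.ext_iff.mp this.1
    exact ⟨Prod.ext (Subtype.ext h1.1) (Subtype.ext h1.2), Subtype.ext this.2⟩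
  left α β x := by
    have := hr.leftCompat α β x
    have h1 := Prod.ext_iff.mp this.1
    exact ⟨Prod.ext (Subtype.ext h1.1) (Subtype.ext h1.2), Subtype.ext this.2⟩
  bijective_l _ β := by
    refine ⟨fun x y hxy => Subtype.ext ((hn β).1.1 (congrArg Subtype.val hxy)), fun x => ?_⟩
    obtain ⟨y, hy : lact r β y = x⟩ := (hn β).1.2 x
    exact ⟨⟨y, hl β β.2 y (hy.symm ▸ x.2)⟩, Subtype.ext hy⟩
  bijective_ρ _ x := by
    refine ⟨fun β γ h => Subtype.ext ((hn x).2.1 (congrArg Subtype.val h)), fun β => ?_⟩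
    obtain ⟨γ, hγ : ract r γ x = β⟩ := (hn x).2.2 β
    exact ⟨⟨γ, hρ x x.2 γ (hγ.symm ▸ β.2)⟩, Subtype.ext hγ⟩
  bijective := by
    refine ⟨fun p q h => ?_, fun p => ?_⟩
    · have := r.injective (a₁ := (p.1.1, p.2.1)) (a₂ := (q.1.1, q.2.1))
        (Prod.ext (congrArg (fun p => p.1.1) h) (congrArg (fun p => p.2.1) h))
      exact Prod.ext (Subtype.ext (congrArg Prod.fst this)) (Subtype.ext (congrArg Prod.snd this))
    · obtain ⟨⟨β, x⟩, h⟩ := r.surjective (p.1.1, p.2.1)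
      have h1 : lact r β x = p.1.1 := congrArg Prod.fst h
      have h2 : ract r β x = p.2.1 := congrArg Prod.snd h
      have hm := hbij β x (h1.symm ▸ p.1.2) (h2.symm ▸ p.2.2)
      exact ⟨(⟨β, hm.1⟩, ⟨x, hm.2⟩), Prod.ext (Subtype.ext h1) (Subtype.ext h2)⟩

variable {X Y : Set Z}

theorem IsGenSTU.mem_or (h : IsGenSTU r X Y) (z : Z) : z ∈ X ∨ z ∈ Y := by
  rw [← Set.mem_union, h.union]; trivial

theorem IsGenSTU.not_mem (h : IsGenSTU r X Y) {z : Z} (hX : z ∈ X) (hY : z ∈ Y) : False :=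
  Set.disjoint_left.mp h.disjoint hX hY

theorem IsInvariant.mem {X : Set Z} (hX : IsInvariant r X) {x y : Z} (hx : x ∈ X) (hy : y ∈ X) :
    lact r x y ∈ X ∧ ract r x y ∈ X :=
  (hX (x, y)).mpr ⟨hx, hy⟩

theorem IsGenSTU.symm (h : IsGenSTU r X Y) : IsGenSTU r Y X where
  disjoint := h.disjoint.symm
  union := (Set.union_comm _ _).trans h.union
  invariant_X := h.invariant_Y
  invariant_Y := h.invariant_X
  map_XY := h.map_YX
  map_YX := h.map_XY
  stu1 x hx y hy α hα := h.stu3 α hα x hx y hy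
  stu2 x hx y hy α hα := h.stu4 α hα x hx y hy
  stu3 x hx α hα β hβ := h.stu1 α hα β hβ x hx
  stu4 x hx α hα β hβ := h.stu2 α hα β hβ x hx

theorem IsGenSTU.groundActions_self (h : IsGenSTU r X Y) (hr : IsBraided r)
    (hn : Nondegenerate r) (G : Prop) :
    GroundActions G (induced r h.invariant_X) (induced r h.invariant_X)
      (lact (induced r h.invariant_X)) (ract (induced r h.invariant_X)) := by
  refine GroundActions.restrict hr hn G h.invariant_X h.invariant_X
    (fun x hx y hy => h.invariant_X.mem hx hy) (fun β hβ x hx => ?_) (fun x hx β hβ => ?_)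
    (fun β x h1 h2 => (h.invariant_X (β, x)).mp ⟨h1, h2⟩)
  · exact (h.mem_or x).resolve_right fun hy => h.not_mem hx (h.map_XY β hβ x hy).1
  · exact (h.mem_or β).resolve_right fun hy => h.not_mem hβ (h.map_YX β hy x hx).2

theorem IsGenSTU.groundActions (h : IsGenSTU r X Y) (hr : IsBraided r) (hn : Nondegenerate r)
    (G : Prop) :
    GroundActions G (induced r h.invariant_X) (induced r h.invariant_Y)
      (fun (β : Y) (x : X) => (⟨lact r β x, (h.map_YX β β.2 x x.2).1⟩ : X))
      (fun (β : Y) (x : X) => (⟨ract r β x, (h.map_YX β β.2 x x.2).2⟩ : Y)) := by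
  refine GroundActions.restrict hr hn G h.invariant_X h.invariant_Y h.map_YX
    (fun β hβ x hx => ?_) (fun x hx β hβ => ?_) (fun β x h1 h2 => ?_)
  · exact (h.mem_or x).resolve_right fun hy => h.not_mem hx (h.invariant_Y.mem hβ hy).1
  · exact (h.mem_or β).resolve_left fun hy => h.not_mem (h.invariant_X.mem hy hx).2 hβ
  · rcases h.mem_or β with hβ | hβ
    · rcases h.mem_or x with hx | hx
      · exact (h.not_mem (h.invariant_X.mem hβ hx).2 h2).elim
      · exact (h.not_mem h1 (h.map_XY β hβ x hx).1).elim
    · exact ⟨hβ, (h.mem_or x).resolve_right fun hy => h.not_mem h1 (h.invariant_Y.mem hβ hy).1⟩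

/-- The common core of both parts of the theorem. The maps `i` and `j` are only required to have the
right values on generators, so they may fail to be injective. -/
theorem IsGenSTU.exists_isCanonicalGenSTU (h : IsGenSTU r X Y) (hr : IsBraided r)
    (hn : Nondegenerate r) {G : Prop} {S T U : Type u} [Monoid S] [Monoid T] [Monoid U]
    {ι : X → S} {κ : Y → T} {ζ : Z → U} (hS : Presents G (induced r h.invariant_X) ι)
    (hT : Presents G (induced r h.invariant_Y) κ) (hU : Presents G r ζ) (i : S →* U) (j : T →* U)
    (hi : ∀ x, i (ι x) = ζ x) (hj : ∀ β, j (κ β) = ζ β) :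
    ∃ (BU : BraidedMonoid U) (BS : BraidedMonoid S) (BT : BraidedMonoid T),
      BU.IsAssociated r ζ ∧ BS.IsAssociated (induced r h.invariant_X) ι ∧
      BT.IsAssociated (induced r h.invariant_Y) κ ∧
      IsCanonicalGenSTU h ι κ BS BT BU i j := by
  have gU := GroundActions.of_isBraided hr hn G
  have gS := h.groundActions_self hr hn G
  have gT := h.symm.groundActions_self hr hn G
  have gP := h.groundActions hr hn G
  have gQ := h.symm.groundActions hr hn G
  obtain ⟨BU, hBU⟩ := gU.exists_braidedMonoid hU hr
  obtain ⟨BS, hBS⟩ := gS.exists_braidedMonoid hS (hr.induced _)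
  obtain ⟨BT, hBT⟩ := gT.exists_braidedMonoid hT (hr.induced _)
  obtain ⟨P, hP⟩ := gP.exists_matchedPair hS hT
  obtain ⟨Q, hQ⟩ := gQ.exists_matchedPair hT hS
  refine ⟨BU, BS, BT, BraidedMonoid.isAssociated hU gU hBU, BraidedMonoid.isAssociated hS gS hBS,
    BraidedMonoid.isAssociated hT gT hBT, P, Q,
    fun x α => ⟨(hP α x).1, (hP α x).2, (hQ x α).1, (hQ x α).2⟩, fun P' Q' hPQ => ⟨?_, ?_⟩, ?_⟩
  · exact MatchedPair.eq_of_extendsMaps hS hT gP hP fun β x => ⟨(hPQ x β).1, (hPQ x β).2.1⟩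
  · exact MatchedPair.eq_of_extendsMaps hT hS gQ hQ fun x β => (hPQ x β).2.2
  · have hSS := BS.map_hom hS hS gS hBS BU.toMatchedPair i i fun x y => by
      simp only [Function.comp, hi]; exact hBU x y
    have hTT := BT.map_hom hT hT gT hBT BU.toMatchedPair j j fun x y => by
      simp only [Function.comp, hj]; exact hBU x y
    have hTS := P.map_hom hS hT gP hP BU.toMatchedPair i j fun x y => by
      simp only [Function.comp, hi, hj]; exact hBU x y
    have hST := Q.map_hom hT hS gQ hQ BU.toMatchedPair j i fun x y => by
      simp only [Function.comp, hi, hj]; exact hBU x y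
    have hcover : ∀ z, (∃ x, ζ z = i (ι x)) ∨ ∃ β, ζ z = j (κ β) := fun z =>
      (h.mem_or z).imp (fun hz => ⟨⟨z, hz⟩, (hi ⟨z, hz⟩).symm⟩)
        (fun hz => ⟨⟨z, hz⟩, (hj ⟨z, hz⟩).symm⟩)
    refine ⟨fun a b => Prod.ext (hSS a b).1.symm (hSS a b).2.symm,
      fun u v => Prod.ext (hTT u v).1.symm (hTT u v).2.symm,
      fun u a => Prod.ext (hTS u a).1.symm (hTS u a).2.symm,
      fun a u => Prod.ext (hST a u).1.symm (hST a u).2.symm,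
      P.bijective_map hS hT gP hP, Q.bijective_map hT hS gQ hQ,
      exists_factorization hS hT hU P i j (fun u a => ?_) hcover,
      exists_factorization hT hS hU Q j i (fun a u => ?_) fun z => (hcover z).symm,
      fun a b u => P.lact_ract_of_gen hS hT gP hP ?_ u a b,
      fun a b u => Q.ract_lact_of_gen hT hS gQ hQ ?_ a b u,
      fun a u v => Q.lact_ract_of_gen hT hS gQ hQ ?_ a u v,
      fun a u v => P.ract_lact_of_gen hS hT gP hP ?_ u v a⟩
    · rw [(hTS u a).1, (hTS u a).2, BU.lact_mul_ract]
    · rw [(hST a u).1, (hST a u).2, BU.lact_mul_ract]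
    · exact fun β x y => Subtype.ext (h.stu1 x x.2 y y.2 β β.2)
    · exact fun x y β => Subtype.ext (h.stu2 x x.2 y y.2 β β.2)
    · exact fun x α β => Subtype.ext (h.stu3 x x.2 α α.2 β β.2)
    · exact fun α β x => Subtype.ext (h.stu4 x x.2 α α.2 β β.2)

/-! ### Injectivity of the canonical homomorphisms -/

-- Sending `Y` to `0` respects the relations because `r` preserves `X × X` and its complement. This
-- one map gives both the injectivity of `S → U` and the trivial intersection of the images.
open scoped Classical in
theorem IsGenSTU.exists_retraction (h : IsGenSTU r X Y) :
    ∃ φ : StrMonoid r →* WithZero (StrMonoid (induced r h.invariant_X)),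
      (∀ a, φ (monoidIncl r h.invariant_X a) = a) ∧
      ∀ u, φ (monoidIncl r h.invariant_Y u) ≠ 0 → u = 1 := by
  obtain ⟨φ, hφ⟩ := (StrMonoid.presents r).lift
    (fun z => if hz : z ∈ X then
      ((StrMonoid.of (induced r h.invariant_X) ⟨z, hz⟩ : StrMonoid (induced r h.invariant_X)) :
        WithZero (StrMonoid (induced r h.invariant_X))) else 0)
    (fun x y => by
      by_cases hxy : x ∈ X ∧ y ∈ X
      · have hm := h.invariant_X.mem hxy.1 hxy.2
        rw [dif_pos hxy.1, dif_pos hxy.2, dif_pos hm.1, dif_pos hm.2, ← WithZero.coe_mul,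
          ← WithZero.coe_mul]
        exact congrArg _ (StrMonoid.of_rel (induced r h.invariant_X) ⟨x, hxy.1⟩ ⟨y, hxy.2⟩)
      · have hm : ¬ (lact r x y ∈ X ∧ ract r x y ∈ X) :=
          fun hm => hxy ((h.invariant_X (x, y)).mp hm)
        rw [not_and_or] at hxy hm
        have h0 : ∀ a b : Z, (a ∉ X ∨ b ∉ X) → (if hz : a ∈ X then
            ((StrMonoid.of (induced r h.invariant_X) ⟨a, hz⟩ :
              StrMonoid (induced r h.invariant_X)) :
              WithZero (StrMonoid (induced r h.invariant_X))) else 0) * (if hz : b ∈ X then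
            ((StrMonoid.of (induced r h.invariant_X) ⟨b, hz⟩ :
              StrMonoid (induced r h.invariant_X)) :
              WithZero (StrMonoid (induced r h.invariant_X))) else 0) = 0 := by
          rintro a b (hab | hab)
          · rw [dif_neg hab, zero_mul]
          · rw [dif_neg hab, mul_zero]
        rw [h0 _ _ hxy, h0 _ _ hm]) False.elim
  refine ⟨φ, ?_, ?_⟩
  · refine (StrMonoid.presents (induced r h.invariant_X)).gen _ ?_ (fun a b ha hb => ?_)
      (fun x => ?_) False.elim
    · rw [map_one, map_one, WithZero.coe_one]
    · rw [map_mul, map_mul, ha, hb, WithZero.coe_mul]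
    · exact (hφ x.1).trans (dif_pos x.2)
  · refine (StrMonoid.presents (induced r h.invariant_Y)).gen _ (fun _ => rfl)
      (fun a b ha hb hab => ?_) (fun x hx => ?_) False.elim
    · rw [map_mul, map_mul] at hab
      rw [ha (left_ne_zero_of_mul hab), hb (right_ne_zero_of_mul hab), one_mul]
    · exact (hx ((hφ x.1).trans (dif_neg fun hX => h.not_mem hX x.2))).elim

theorem IsGenSTU.monoidIncl_injective (h : IsGenSTU r X Y) :
    Function.Injective (monoidIncl r h.invariant_X) := by
  obtain ⟨φ, hφ, -⟩ := h.exists_retraction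
  intro a b hab
  rw [← WithZero.coe_inj, ← hφ, ← hφ, hab]

theorem IsGenSTU.eq_one_of_monoidIncl_eq (h : IsGenSTU r X Y)
    (a : StrMonoid (induced r h.invariant_X)) (u : StrMonoid (induced r h.invariant_Y))
    (hau : monoidIncl r h.invariant_X a = monoidIncl r h.invariant_Y u) : a = 1 ∧ u = 1 := by
  obtain ⟨φ, hφ, hφ'⟩ := h.exists_retraction
  have hu : u = 1 := hφ' u (by rw [← hau, hφ]; exact WithZero.coe_ne_zero)
  refine ⟨h.monoidIncl_injective ?_, hu⟩
  rw [hau, hu, map_one, map_one]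

theorem groupIncl_of (hX : IsInvariant r X) (x : X) :
    groupIncl r hX (StrGroup.of _ x) = StrGroup.of r x :=
  PresentedGroup.toGroup.of _

/-- The injective map `X → Z → G_Z` factors through `G_X`. -/
theorem IsInjective.induced (hZ : IsInjective r) (hX : IsInvariant r X) :
    IsInjective (induced r hX) := fun x y hxy =>
  Subtype.ext (hZ (by rw [← groupIncl_of hX, ← groupIncl_of hX, hxy]))

end

end QuadraticSet

/-! ### The theorem for monoids and for groups -/

theorem mainTheorem3 {Z : Type*} (r : Equiv.Perm (Z × Z))
    (hbraided : QuadraticSet.IsBraided r) (hnondeg : QuadraticSet.Nondegenerate r)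
    (hcancel : QuadraticSet.TwoCancellative r)
    (X Y : Set Z) (h : QuadraticSet.IsGenSTU r X Y) :
    (∃ (BU : QuadraticSet.BraidedMonoid (QuadraticSet.StrMonoid r))
        (BS : QuadraticSet.BraidedMonoid
          (QuadraticSet.StrMonoid (QuadraticSet.induced r h.invariant_X)))
        (BT : QuadraticSet.BraidedMonoid
          (QuadraticSet.StrMonoid (QuadraticSet.induced r h.invariant_Y))),
      BU.IsAssociated r (QuadraticSet.StrMonoid.of r) ∧
      BS.IsAssociated (QuadraticSet.induced r h.invariant_X) (QuadraticSet.StrMonoid.of _) ∧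
      BT.IsAssociated (QuadraticSet.induced r h.invariant_Y) (QuadraticSet.StrMonoid.of _) ∧
      Function.Injective (QuadraticSet.monoidIncl r h.invariant_X) ∧
      Function.Injective (QuadraticSet.monoidIncl r h.invariant_Y) ∧
      (∀ a u, QuadraticSet.monoidIncl r h.invariant_X a = QuadraticSet.monoidIncl r h.invariant_Y u →
        a = 1 ∧ u = 1) ∧
      QuadraticSet.IsCanonicalGenSTU h (QuadraticSet.StrMonoid.of _) (QuadraticSet.StrMonoid.of _)
        BS BT BU (QuadraticSet.monoidIncl r h.invariant_X)
        (QuadraticSet.monoidIncl r h.invariant_Y)) ∧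
    (QuadraticSet.IsInjective r →
      QuadraticSet.IsInjective (QuadraticSet.induced r h.invariant_X) ∧
      QuadraticSet.IsInjective (QuadraticSet.induced r h.invariant_Y) ∧
      ∃ (BZ : QuadraticSet.BraidedMonoid (QuadraticSet.StrGroup r))
        (BX : QuadraticSet.BraidedMonoid
          (QuadraticSet.StrGroup (QuadraticSet.induced r h.invariant_X)))
        (BY : QuadraticSet.BraidedMonoid
          (QuadraticSet.StrGroup (QuadraticSet.induced r h.invariant_Y))),
        BZ.IsAssociated r (QuadraticSet.StrGroup.of r) ∧
        BX.IsAssociated (QuadraticSet.induced r h.invariant_X) (QuadraticSet.StrGroup.of _) ∧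
        BY.IsAssociated (QuadraticSet.induced r h.invariant_Y) (QuadraticSet.StrGroup.of _) ∧
        QuadraticSet.IsCanonicalGenSTU h (QuadraticSet.StrGroup.of _) (QuadraticSet.StrGroup.of _)
          BX BY BZ (QuadraticSet.groupIncl r h.invariant_X)
          (QuadraticSet.groupIncl r h.invariant_Y)) := by
  refine ⟨?_, fun hZ => ⟨hZ.induced _, hZ.induced _, ?_⟩⟩
  · obtain ⟨BU, BS, BT, hU, hS, hT, hST⟩ := h.exists_isCanonicalGenSTU hbraided hnondeg
      (QuadraticSet.StrMonoid.presents _) (QuadraticSet.StrMonoid.presents _)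
      (QuadraticSet.StrMonoid.presents r) (QuadraticSet.monoidIncl r h.invariant_X)
      (QuadraticSet.monoidIncl r h.invariant_Y) (fun _ => rfl) (fun _ => rfl)
    exact ⟨BU, BS, BT, hU, hS, hT, h.monoidIncl_injective, h.symm.monoidIncl_injective,
      h.eq_one_of_monoidIncl_eq, hST⟩
  · exact h.exists_isCanonicalGenSTU hbraided hnondeg
      (QuadraticSet.StrGroup.presents _) (QuadraticSet.StrGroup.presents _)
      (QuadraticSet.StrGroup.presents r) (QuadraticSet.groupIncl r h.invariant_X)
      (QuadraticSet.groupIncl r h.invariant_Y) (QuadraticSet.groupIncl_of _)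
      (QuadraticSet.groupIncl_of _)
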